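/- Let $c>0$ and put $r=r(x)=x-ic$, $x\in\mathbb R$. For $\xi\in\mathbb R$ let $$H^{(\xi)}=-\frac{d^2}{dr^2}+\frac{\xi^2-1/4}{r^2}+r^2$$ be realized in $L^2(\mathbb R,dx)$ (with $d/dr=d/dx$) on its maximal domain, i.e. on all $f\in L^2(\mathbb R)$ for which $H^{(\xi)}f$, in the sense of distributions, lies in $L^2(\mathbb R)$. For $\gamma\in\mathbb R$ define the sub-Hamiltonians $$H_{(L)}(\gamma)=H^{(|\gamma|)}-2\gamma-2,\qquad H_{(R)}(\gamma)=H^{(|\gamma+1|)}-2\gamma ,$$ the superpotential $W=r-\frac{\gamma+1/2}{r}$, and $A=\partial_x+W$, $B=-\partial_x+W$. A parameter $\gamma$ is called an exceptional point (EP) of a family $T(\gamma)$ of operators if $T(\gamma)$ has an eigenvalue whose algebraic multiplicity (dimension of the space of generalized eigenvectors) differs from its geometric multiplicity. An operator $T$ in $L^2(\mathbb R)$ is called diagonalizable if there are numbers $E_n$, right eigenvectors $\varphi_n$ ($T\varphi_n=E_n\varphi_n$) and left eigenvectors $\chi_n$ ($\langle\chi_n,T\psi\rangle=E_n\langle\chi_n,\psi\rangle$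 for all $\psi\in\mathrm{dom}\,T$), $n=0,1,2,\dots$, with $\langle\chi_m,\varphi_n\rangle=\delta_{mn}$, such that each of the systems $(\varphi_n)$ and $(\chi_n)$ has dense linear span in $L^2(\mathbb R)$. A parameter $\gamma$ is called admissible if $H_{(L)}(\gamma)$ and $H_{(R)}(\gamma)$ are both diagonalizable and have only real eigenvalues. Then: 1. For every $\gamma\in\mathbb R$, as differential operators on smooth functions, $\mathcal G=\begin{pmatrix}H_{(L)}&0\\0&H_{(R)}\end{pmatrix}$, $\mathcal Q=\begin{pmatrix}0&0\\A&0\end{pmatrix}$, $\tilde{\mathcal Q}=\begin{pmatrix}0&B\\0&0\end{pmatrix}$ satisfy the $sl(1|1)$ relations $\{\mathcal Q,\tilde{\mathcal Q}\}=\mathcal G$, $\{\mathcal Q,\mathcal Q\}=\{\tilde{\mathcal Q},\tilde{\mathcal Q}\}=0$, $[\mathcal G,\mathcal Q]=[\mathcal G,\tilde{\mathcal Q}]=0$. 2. The set of exceptional points of $H_{(L)}$ and the set of exceptional points of $H_{(R)}$ are both equal to $\mathbb Z$, and for $\gamma\in\mathbb Z$ neither $H_{(L)}(\gamma)$ nor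 $H_{(R)}(\gamma)$ is diagonalizable. 3. The set of admissible parameters is $\mathbb R\setminus\mathbb Z$. The connected component of an admissible $\gamma$ in this set is the open unit interval $(\lfloor\gamma\rfloor,\lfloor\gamma\rfloor+1)$; the connected components are exactly the intervals $(K,K+1)$, $K\in\mathbb Z$, whose endpoints are two neighbouring integers, and there are infinitely many of them. -/

import Mathlib

open MeasureTheory Set
open scoped ContDiff InnerProductSpace

noncomputable section

namespace SusyEP

/-! ### Eigenvalues, multiplicities and diagonalizability of unbounded operators -/

section Operators

variable {X : Type*} [NormedAddCommGroup X] [InnerProductSpace ℂ X]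

/-- The map `T - E`, defined on the domain of `T`. -/
def shifted (T : X →ₗ.[ℂ] X) (E : ℂ) : T.domain →ₗ[ℂ] X :=
  T.toFun - E • T.domain.subtype

/-- The eigenspace `ker (T - E)`. -/
def eigenspace (T : X →ₗ.[ℂ] X) (E : ℂ) : Submodule ℂ X :=
  (LinearMap.ker (shifted T E)).map T.domain.subtype

/-- `ker (T - E) ^ k` : the vectors `f` to which `T - E` can be applied `k` times (all the
intermediate vectors being in the domain of `T`), with result `0`. -/
def kerPow (T : X →ₗ.[ℂ] X) (E : ℂ) : ℕ → Submodule ℂ X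
  | 0 => ⊥
  | k + 1 => ((kerPow T E k).comap (shifted T E)).map T.domain.subtype

/-- The root space (space of generalized eigenvectors) of `T` at `E`. -/
def rootSpace (T : X →ₗ.[ℂ] X) (E : ℂ) : Submodule ℂ X :=
  ⨆ k, kerPow T E k

def IsEigenvalue (T : X →ₗ.[ℂ] X) (E : ℂ) : Prop :=
  eigenspace T E ≠ ⊥

def geometricMultiplicity (T : X →ₗ.[ℂ] X) (E : ℂ) : Cardinal :=
  Module.rank ℂ (eigenspace T E)

def algebraicMultiplicity (T : X →ₗ.[ℂ] X) (E : ℂ) : Cardinal :=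
  Module.rank ℂ (rootSpace T E)

/-- `γ` is an exceptional point of the family `T` if some eigenvalue of `T γ` has
different algebraic and geometric multiplicities. -/
def IsExceptionalPoint (T : ℝ → X →ₗ.[ℂ] X) (γ : ℝ) : Prop :=
  ∃ E : ℂ, IsEigenvalue (T γ) E ∧
    algebraicMultiplicity (T γ) E ≠ geometricMultiplicity (T γ) E

/-- Diagonalizability in an infinite-dimensional separable space: there are right eigenvectors
`φ n` (`T φ = E φ`) and left eigenvectors `χ n` (`⟨χ| T = E ⟨χ|` on the domain of `T`), which
are biorthonormal, and each of the two systems is complete. -/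
def IsDiagonalizable (T : X →ₗ.[ℂ] X) : Prop :=
  ∃ (E : ℕ → ℂ) (φ χ : ℕ → X),
    (∀ n, φ n ∈ eigenspace T (E n)) ∧
    (∀ n, ∀ ψ : T.domain, ⟪χ n, T ψ⟫_ℂ = E n * ⟪χ n, (ψ : X)⟫_ℂ) ∧
    (∀ m n, ⟪χ m, φ n⟫_ℂ = if m = n then 1 else 0) ∧
    Dense (Submodule.span ℂ (range φ) : Set X) ∧
    Dense (Submodule.span ℂ (range χ) : Set X)

end Operators

/-! ### Differential operators on smooth functions on the line -/

/-- The algebra of smooth functions `ℝ → ℂ`. -/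
def smoothFunctions : Subalgebra ℂ (ℝ → ℂ) where
  carrier := {f | ContDiff ℝ ∞ f}
  mul_mem' {f g} (hf : ContDiff ℝ ∞ f) (hg : ContDiff ℝ ∞ g) := hf.mul hg
  add_mem' {f g} (hf : ContDiff ℝ ∞ f) (hg : ContDiff ℝ ∞ g) := hf.add hg
  algebraMap_mem' a := (contDiff_const : ContDiff ℝ ∞ fun _ : ℝ => a)

lemma smooth_contDiff (u : smoothFunctions) : ContDiff ℝ ∞ u.1 := u.2

/-- `d/dx` on smooth functions. -/
def D : Module.End ℂ smoothFunctions where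
  toFun f := ⟨deriv f.1, (contDiff_infty_iff_deriv.1 f.2).2⟩
  map_add' f g := by
    ext x
    exact deriv_add ((contDiff_infty_iff_deriv.1 f.2).1 x) ((contDiff_infty_iff_deriv.1 g.2).1 x)
  map_smul' a f := by
    ext x
    exact deriv_const_smul a ((contDiff_infty_iff_deriv.1 f.2).1 x)

/-- Multiplication by the smooth function `V`. -/
def mulOp (V : smoothFunctions) : Module.End ℂ smoothFunctions :=
  LinearMap.mulLeft ℂ V

/-- The differential expression `-d²/dx² + V`. -/
def schrodingerExpr (V : smoothFunctions) : Module.End ℂ smoothFunctions :=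
  -(D * D) + mulOp V

/-! ### The Hilbert space `L²(ℝ)` and the maximal realization of `-d²/dx² + V` -/

/-- The Hilbert space `L²(ℝ)` of complex-valued functions. -/
abbrev L2R : Type := Lp ℂ 2 (volume : Measure ℝ)

lemma integrable_mul_of_compact (f : L2R) (u : smoothFunctions) (hu : HasCompactSupport u.1) :
    Integrable (fun x => f x * u.1 x) := by
  have h : MemLp u.1 2 volume := (smooth_contDiff u).continuous.memLp_of_hasCompactSupport hu
  exact (Lp.memLp f).integrable_mul h

lemma compact_schrodingerExpr (V φ : smoothFunctions) (hφ : HasCompactSupport φ.1) :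
    HasCompactSupport (schrodingerExpr V φ).1 :=
  (hφ.deriv.deriv.neg).add (hφ.mul_left (f := V.1))

/-- The pairs `(f, h)` in `L² × L²` such that `-f'' + V f = h` in the sense of distributions. -/
def schrodingerGraph (V : smoothFunctions) : Submodule ℂ (L2R × L2R) where
  carrier := {p | ∀ φ : smoothFunctions, HasCompactSupport φ.1 →
    ∫ x, p.1 x * (schrodingerExpr V φ).1 x = ∫ x, p.2 x * φ.1 x}
  zero_mem' φ _ := by
    have h : ∀ u : ℝ → ℂ, ∫ x, (0 : L2R) x * u x = 0 := fun u => by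
      simp
    exact (h _).trans (h _).symm
  add_mem' {p q} hp hq φ hφ := by
    have h : ∀ (f g : L2R) (u : smoothFunctions), HasCompactSupport u.1 →
        ∫ x, (f + g) x * u.1 x = (∫ x, f x * u.1 x) + ∫ x, g x * u.1 x := fun f g u hu => by
      rw [← integral_add (integrable_mul_of_compact f u hu) (integrable_mul_of_compact g u hu)]
      apply integral_congr_ae
      filter_upwards [Lp.coeFn_add f g] with x hx
      rw [hx, Pi.add_apply, add_mul]
    change ∫ x, (p.1 + q.1) x * _ = ∫ x, (p.2 + q.2) x * _
    rw [h _ _ _ (compact_schrodingerExpr V φ hφ), h _ _ _ hφ, hp φ hφ, hq φ hφ]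
  smul_mem' a p hp φ hφ := by
    have h : ∀ (f : L2R) (u : ℝ → ℂ),
        ∫ x, (a • f) x * u x = a * ∫ x, f x * u x := fun f u => by
      rw [← integral_const_mul]
      apply integral_congr_ae
      filter_upwards [Lp.coeFn_smul a f] with x hx
      rw [hx, Pi.smul_apply, smul_eq_mul, mul_assoc]
    change ∫ x, (a • p.1) x * _ = ∫ x, (a • p.2) x * _
    rw [h, h, hp φ hφ]

/-- The maximal realization of `-d²/dx² + V` in `L²(ℝ)`: its domain consists of all `f` in `L²`
for which `-f'' + V f`, taken in the sense of distributions, is again in `L²`. -/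
def schrodingerOp (V : smoothFunctions) : L2R →ₗ.[ℂ] L2R :=
  (schrodingerGraph V).toLinearPMap

lemma schrodingerGraph_single_valued (V : smoothFunctions) (p : L2R × L2R)
    (hp : p ∈ schrodingerGraph V) (h0 : p.1 = 0) : p.2 = 0 := by
  have key : ∀ φ : smoothFunctions, HasCompactSupport φ.1 → ∫ x, p.2 x * φ.1 x = 0 := by
    intro φ hφ
    rw [← hp φ hφ]
    simp [h0]
  rw [Lp.eq_zero_iff_ae_eq_zero]
  refine ae_eq_zero_of_integral_contDiff_smul_eq_zero
    ((Lp.memLp p.2).locallyIntegrable (by norm_num)) ?_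
  intro g hg hgc
  have := key ⟨fun x => (g x : ℂ), Complex.ofRealCLM.contDiff.comp hg⟩
    (hgc.comp_left (g := fun y : ℝ => (y : ℂ)) (by simp))
  rw [← this]
  refine integral_congr_ae (Filter.Eventually.of_forall fun x => ?_)
  simp [mul_comm]

/-- `schrodingerOp V` is the operator whose graph is `schrodingerGraph V`. -/
lemma schrodingerOp_graph (V : smoothFunctions) :
    (schrodingerOp V).graph = schrodingerGraph V :=
  Submodule.toLinearPMap_graph_eq _ fun p hp h0 => schrodingerGraph_single_valued V p hp h0

/-! ### The complex-shift-regularized supersymmetric harmonic oscillators -/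

variable {c : ℝ}

/-- The complex coordinate `r(x) = x - i c`. -/
def coord (c : ℝ) : smoothFunctions :=
  ⟨fun x => (x : ℂ) - Complex.I * c,
    show ContDiff ℝ ∞ fun x : ℝ => (x : ℂ) - Complex.I * c from
      Complex.ofRealCLM.contDiff.sub contDiff_const⟩

lemma coord_ne_zero (hc : 0 < c) (x : ℝ) : (coord c).1 x ≠ 0 := by
  intro h
  have := congrArg Complex.im h
  simp [coord] at this
  exact hc.ne' this

/-- The function `1 / r(x)`, for `c > 0`. -/
def coordInv (hc : 0 < c) : smoothFunctions :=
  ⟨fun x => ((coord c).1 x)⁻¹,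
    show ContDiff ℝ ∞ fun x : ℝ => ((coord c).1 x)⁻¹ from
      (smooth_contDiff (coord c)).inv (coord_ne_zero hc)⟩

/-- The potential `(ξ² - 1/4) / r² + r²`. -/
def oscPotential (hc : 0 < c) (ξ : ℝ) : smoothFunctions :=
  ((ξ : ℂ) ^ 2 - 1 / 4) • coordInv hc ^ 2 + coord c ^ 2

/-- The superpotential `W = r - (γ + 1/2) / r`. -/
def superpotential (hc : 0 < c) (γ : ℝ) : smoothFunctions :=
  coord c - ((γ : ℂ) + 1 / 2) • coordInv hc

/-- The oscillator Hamiltonian `H^(ξ) = -d²/dr² + (ξ² - 1/4) / r² + r²` in `L²(ℝ)`. -/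
def oscillator (hc : 0 < c) (ξ : ℝ) : L2R →ₗ.[ℂ] L2R :=
  schrodingerOp (oscPotential hc ξ)

/-- `H_(L) = H^(α) - 2γ - 2` with `α = |γ|`. -/
def hamL (hc : 0 < c) (γ : ℝ) : L2R →ₗ.[ℂ] L2R :=
  (-(2 * (γ : ℂ) + 2) • (LinearMap.id : L2R →ₗ[ℂ] L2R)) +ᵥ oscillator hc |γ|

/-- `H_(R) = H^(β) - 2γ` with `β = |γ + 1|`. -/
def hamR (hc : 0 < c) (γ : ℝ) : L2R →ₗ.[ℂ] L2R :=
  (-(2 * (γ : ℂ)) • (LinearMap.id : L2R →ₗ[ℂ] L2R)) +ᵥ oscillator hc |γ + 1|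

/-- The differential expression of `H_(L)`. -/
def exprL (hc : 0 < c) (γ : ℝ) : Module.End ℂ smoothFunctions :=
  schrodingerExpr (oscPotential hc |γ|) - (2 * (γ : ℂ) + 2) • 1

/-- The differential expression of `H_(R)`. -/
def exprR (hc : 0 < c) (γ : ℝ) : Module.End ℂ smoothFunctions :=
  schrodingerExpr (oscPotential hc |γ + 1|) - (2 * (γ : ℂ)) • 1

/-- `A = d/dx + W`. -/
def opA (hc : 0 < c) (γ : ℝ) : Module.End ℂ smoothFunctions :=
  D + mulOp (superpotential hc γ)

/-- `B = -d/dx + W`. -/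
def opB (hc : 0 < c) (γ : ℝ) : Module.End ℂ smoothFunctions :=
  -D + mulOp (superpotential hc γ)

/-- Two-by-two matrices of differential operators. -/
abbrev SuperOp : Type := Matrix (Fin 2) (Fin 2) (Module.End ℂ smoothFunctions)

/-- The super-Hamiltonian. -/
def superG (hc : 0 < c) (γ : ℝ) : SuperOp := !![exprL hc γ, 0; 0, exprR hc γ]

/-- The supercharge built from `A`. -/
def superQ (hc : 0 < c) (γ : ℝ) : SuperOp := !![0, 0; opA hc γ, 0]

/-- The supercharge built from `B`. -/
def superQt (hc : 0 < c) (γ : ℝ) : SuperOp := !![0, opB hc γ; 0, 0]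

/-- The relations of the Lie superalgebra `sl(1|1)`. -/
structure IsSl11 (G Q Qt : SuperOp) : Prop where
  anticomm : Q * Qt + Qt * Q = G
  anticomm_self : Q * Q + Q * Q = 0
  anticomm_self' : Qt * Qt + Qt * Qt = 0
  comm : G * Q - Q * G = 0
  comm' : G * Qt - Qt * G = 0

/-- The admissible parameters: both sub-Hamiltonians are diagonalizable, with real
eigenvalues. -/
def admissible (hc : 0 < c) : Set ℝ :=
  {γ | (IsDiagonalizable (hamL hc γ) ∧ ∀ E, IsEigenvalue (hamL hc γ) E → E.im = 0) ∧
    (IsDiagonalizable (hamR hc γ) ∧ ∀ E, IsEigenvalue (hamR hc γ) E → E.im = 0)}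

end SusyEP

end

open SusyEP

noncomputable section

namespace SusyEP

/-! ### Abstract operators -/

section Abstract

variable {X : Type*} [NormedAddCommGroup X] [InnerProductSpace ℂ X]

/-! The algebraic relations come from the factorizations $BA=H_{(L)}$ and $AB=H_{(R)}$. Everything
spectral concerns $H^{(\xi)}$ alone, since both sub-Hamiltonians are translates of it by real
constants, with $\xi=|\gamma|$ and $\xi=|\gamma+1|$, and both parameters are integers exactly when
$\gamma$ is.

Put $w=ir=c+ix$, so that $\mathrm{Re}\,w=c>0$ and all real powers of $w$ are smooth. The functions
$u_m=w^m e^{w^2/2}$ have Gaussian decay and satisfy $Hu_m=(2m+1)u_m+((m-1/2)^2-\xi^2)u_{m-2}$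
(`schrodingerExpr_wfun`). Hence $m=1/2\pm\xi+2k$ gives two ladders on which $H$ is triangular, with
diagonal entries $4k+2\pm2\xi$.

If $\xi$ is not an integer, these entries are pairwise distinct, and elimination turns the ladders
into eigenfunctions. $H$ is symmetric for the bilinear pairing $\int fg$, so conjugates of
eigenfunctions are left eigenvectors, and diagonalizability reduces to completeness
(`isDiagonalizable_of_complete`). For completeness (`eq_zero_of_moments_eq_zero`), let $h$
annihilate both ladders and set $F_m(s)=\int h\,u_m e^{sw}$. Vanishing moments make $F_{1/2\pm\xi}$
odd, hence $O(e^{-c|s|})$. Since $\Gamma(a)w^{-a}=\int_0^\infty t^{a-1}e^{-wt}dt$, $F_{1/2-\xi}$ is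
the fractional integral of order $a=2\xi$ of $F_{1/2+\xi}$, so on the imaginary axis their Laplace
transforms differ by the factor $z^{-a}$. Both transforms are odd while $z^{-a}$ is not even, so
both vanish, and Fourier injectivity gives $h=0$.

If $\xi=n$ is a natural number, reduction of order on $u=u_{1/2+n}$ gives an explicit
square-integrable $f$ with $(H-E)f=u$ (`wfun_chain`). As the eigenspace is finite-dimensional, this
root vector separates the multiplicities. A complete system of left eigenvectors forbids such
vectors (`IsDiagonalizable.rootSpace_eq`), so exceptional points and diagonalizable parameters
exclude each other. -/

lemma mem_eigenspace_iff (T : X →ₗ.[ℂ] X) (E : ℂ) (f : X) :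
    f ∈ eigenspace T E ↔ (f, E • f) ∈ T.graph := by
  rw [LinearPMap.mem_graph_iff]
  simp only [eigenspace, Submodule.mem_map, LinearMap.mem_ker, shifted]
  constructor
  · rintro ⟨y, hy, rfl⟩
    exact ⟨y, rfl, sub_eq_zero.1 hy⟩
  · rintro ⟨y, rfl, hy⟩
    exact ⟨y, sub_eq_zero.2 hy, rfl⟩

lemma mem_kerPow_succ_iff (T : X →ₗ.[ℂ] X) (E : ℂ) (k : ℕ) (f : X) :
    f ∈ kerPow T E (k + 1) ↔ ∃ g ∈ kerPow T E k, (f, E • f + g) ∈ T.graph := by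
  simp only [kerPow, Submodule.mem_map, Submodule.mem_comap, shifted, LinearPMap.mem_graph_iff]
  constructor
  · rintro ⟨y, hy, rfl⟩
    refine ⟨_, hy, y, rfl, ?_⟩
    change T y = E • (y : X) + (T y - E • (y : X))
    abel
  · rintro ⟨g, hg, y, rfl, hy⟩
    refine ⟨y, ?_, rfl⟩
    change T y - E • (y : X) ∈ _
    change T y = E • (y : X) + g at hy
    rw [hy]
    simpa using hg

lemma kerPow_one (T : X →ₗ.[ℂ] X) (E : ℂ) : kerPow T E 1 = eigenspace T E := by
  ext f
  rw [mem_kerPow_succ_iff, mem_eigenspace_iff]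
  simp [kerPow]

/-- A vector orthogonal to a dense span vanishes. -/
lemma eq_zero_of_forall_inner_eq_zero {χ : ℕ → X}
    (h : Dense (Submodule.span ℂ (range χ) : Set X)) {f : X} (hf : ∀ n, ⟪χ n, f⟫_ℂ = 0) :
    f = 0 := by
  refine h.eq_zero_of_inner_left (𝕜 := ℂ) fun v hv => ?_
  induction hv using Submodule.span_induction with
  | mem x hx => obtain ⟨n, rfl⟩ := hx; rw [← inner_conj_symm, hf, map_zero]
  | zero => simp
  | add x y _ _ hx hy => rw [inner_add_right, hx, hy, add_zero]
  | smul a x _ hx => rw [inner_smul_right, hx, mul_zero]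

/-- Eigenvalues of an operator with a complete system of left eigenvectors. -/
lemma exists_eq_of_isEigenvalue {T : X →ₗ.[ℂ] X} {E : ℕ → ℂ} {χ : ℕ → X}
    (hχ : ∀ n, ∀ ψ : T.domain, ⟪χ n, T ψ⟫_ℂ = E n * ⟪χ n, (ψ : X)⟫_ℂ)
    (hd : Dense (Submodule.span ℂ (range χ) : Set X)) {e : ℂ} (he : IsEigenvalue T e) :
    ∃ n, e = E n := by
  obtain ⟨f, hf, hf0⟩ := (Submodule.ne_bot_iff _).1 he
  rw [mem_eigenspace_iff, LinearPMap.mem_graph_iff] at hf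
  obtain ⟨y, rfl, hy⟩ := hf
  by_contra! hne
  refine hf0 (eq_zero_of_forall_inner_eq_zero hd fun n => ?_)
  have h := hχ n y
  rw [hy] at h
  simp only [inner_smul_right] at h
  exact (mul_eq_mul_right_iff.1 h).resolve_left (hne n)

/-- Diagonalizable operators have no root vectors besides eigenvectors. -/
lemma IsDiagonalizable.rootSpace_eq {T : X →ₗ.[ℂ] X} (h : IsDiagonalizable T) (e : ℂ) :
    rootSpace T e = eigenspace T e := by
  obtain ⟨E, φ, χ, -, hχ, -, -, hd⟩ := h
  -- Test $(T-e)f=g$ against $\chi_n$: if $e=E_n$ the left side drops out; if $e\ne E_n$ the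
  -- eigenvector $g$ is orthogonal to $\chi_n$ anyway.
  have hstep : ∀ f g : X, g ∈ eigenspace T e → (f, e • f + g) ∈ T.graph → g = 0 := by
    intro f g hg hfg
    rw [mem_eigenspace_iff, LinearPMap.mem_graph_iff] at hg
    rw [LinearPMap.mem_graph_iff] at hfg
    obtain ⟨y, rfl, hy⟩ := hfg
    obtain ⟨z, rfl, hz⟩ := hg
    refine eq_zero_of_forall_inner_eq_zero hd fun n => ?_
    have h1 := hχ n y
    have h2 := hχ n z
    rw [hy] at h1
    rw [hz] at h2
    simp only [inner_smul_right, inner_add_right] at h1 h2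
    by_cases hne : e = E n
    · subst hne
      simpa using h1
    · exact (mul_eq_mul_right_iff.1 h2).resolve_left hne
  have hk : ∀ k, kerPow T e k ≤ eigenspace T e := by
    intro k
    induction k with
    | zero => exact bot_le
    | succ k ih =>
      intro f hf
      obtain ⟨g, hg, hfg⟩ := (mem_kerPow_succ_iff _ _ _ _).1 hf
      have := hstep f g (ih hg) hfg
      subst this
      rw [mem_eigenspace_iff]
      simpa using hfg
  exact le_antisymm (iSup_le hk) (kerPow_one T e ▸ le_iSup (kerPow T e) 1)

lemma IsExceptionalPoint.not_isDiagonalizable {T : ℝ → X →ₗ.[ℂ] X} {γ : ℝ}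
    (h : IsExceptionalPoint T γ) : ¬ IsDiagonalizable (T γ) := by
  intro hd
  obtain ⟨e, -, hne⟩ := h
  apply hne
  rw [algebraicMultiplicity, geometricMultiplicity, hd.rootSpace_eq]

/-- A Jordan chain of length two over a finite-dimensional eigenspace. -/
lemma algebraicMultiplicity_ne {T : X →ₗ.[ℂ] X} {e : ℂ} {f g : X}
    (hfin : FiniteDimensional ℂ (eigenspace T e)) (hg : g ∈ eigenspace T e) (hg0 : g ≠ 0)
    (hfg : (f, e • f + g) ∈ T.graph) :
    algebraicMultiplicity T e ≠ geometricMultiplicity T e := by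
  intro h
  have hle : eigenspace T e ≤ rootSpace T e := kerPow_one T e ▸ le_iSup (kerPow T e) 1
  -- The multiplicities are cardinals, and equal infinite ranks would not force equal spaces;
  -- finiteness makes the inclusion an equality.
  have hlt : Module.rank ℂ (rootSpace T e) < Cardinal.aleph0 := by
    change algebraicMultiplicity T e < _
    rw [h]
    exact Module.rank_lt_aleph0 ℂ _
  have : FiniteDimensional ℂ (rootSpace T e) := Module.rank_lt_aleph0_iff.1 hlt
  have heq : eigenspace T e = rootSpace T e :=
    Submodule.eq_of_le_of_finrank_eq hle (congrArg Cardinal.toNat h.symm)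
  have hf : f ∈ eigenspace T e := by
    rw [heq]
    refine le_iSup (kerPow T e) 2 ((mem_kerPow_succ_iff T e 1 f).2 ⟨g, ?_, hfg⟩)
    rwa [kerPow_one]
  rw [mem_eigenspace_iff] at hf
  have := T.graph.sub_mem hfg hf
  have := T.graph_fst_eq_zero_snd this (by simp)
  exact hg0 (by simpa using this)

/-- The translate of an operator by a multiple of the identity. -/
def translate (a : ℂ) (S : X →ₗ.[ℂ] X) : X →ₗ.[ℂ] X :=
  (a • (LinearMap.id : X →ₗ[ℂ] X)) +ᵥ S

lemma translate_apply (a : ℂ) (S : X →ₗ.[ℂ] X) (ψ : (translate a S).domain) :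
    translate a S ψ = a • (ψ : X) + S ⟨ψ, ψ.2⟩ := rfl

lemma shifted_translate (a : ℂ) (S : X →ₗ.[ℂ] X) (e : ℂ) :
    shifted (translate a S) (e + a) = shifted S e := by
  refine LinearMap.ext fun ψ => ?_
  change translate a S ψ - (e + a) • (ψ : X) = S ψ - e • (ψ : X)
  rw [translate_apply, add_smul]
  change a • (ψ : X) + S ψ - _ = _
  abel

lemma eigenspace_translate (a : ℂ) (S : X →ₗ.[ℂ] X) (e : ℂ) :
    eigenspace (translate a S) (e + a) = eigenspace S e := by
  unfold eigenspace
  rw [shifted_translate]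
  rfl

lemma kerPow_translate (a : ℂ) (S : X →ₗ.[ℂ] X) (e : ℂ) (k : ℕ) :
    kerPow (translate a S) (e + a) k = kerPow S e k := by
  induction k with
  | zero => rfl
  | succ k ih =>
    unfold kerPow
    rw [shifted_translate, ih]
    rfl

lemma isEigenvalue_translate {a : ℂ} {S : X →ₗ.[ℂ] X} {e : ℂ} :
    IsEigenvalue (translate a S) (e + a) ↔ IsEigenvalue S e := by
  rw [IsEigenvalue, eigenspace_translate, IsEigenvalue]

lemma multiplicity_translate {a : ℂ} {S : X →ₗ.[ℂ] X} {e : ℂ}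
    (h : algebraicMultiplicity S e ≠ geometricMultiplicity S e) :
    algebraicMultiplicity (translate a S) (e + a) ≠
      geometricMultiplicity (translate a S) (e + a) := by
  have hr : rootSpace (translate a S) (e + a) = rootSpace S e :=
    iSup_congr (kerPow_translate a S e)
  rw [algebraicMultiplicity, geometricMultiplicity, hr, eigenspace_translate]
  exact h

lemma IsDiagonalizable.translate {S : X →ₗ.[ℂ] X} (h : IsDiagonalizable S) (a : ℂ) :
    IsDiagonalizable (translate a S) := by
  obtain ⟨E, φ, χ, h1, h2, h3⟩ := h
  refine ⟨fun n => E n + a, φ, χ, fun n => ?_, fun n ψ => ?_, h3⟩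
  · rw [eigenspace_translate]
    exact h1 n
  · rw [translate_apply, inner_add_right, inner_smul_right, h2 n]
    ring

/-- If `G` is a linear relation acting triangularly on the sequence `v`, with diagonal entries
`l`, then `G - e` is onto the span of the first `n` vectors, for `e ≠ l k`, `k < n`. -/
lemma exists_solution_of_triangular {Y : Type*} [AddCommGroup Y] [Module ℂ Y]
    (G : Submodule ℂ (Y × Y)) (v : ℕ → Y) (l b : ℕ → ℂ)
    (h0 : (v 0, l 0 • v 0) ∈ G)
    (hs : ∀ k, (v (k + 1), l (k + 1) • v (k + 1) + b k • v k) ∈ G) (e : ℂ) (n : ℕ)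
    (he : ∀ k < n, e ≠ l k) (y : Y) (hy : y ∈ Submodule.span ℂ (v '' Iio n)) :
    ∃ x ∈ Submodule.span ℂ (v '' Iio n), (x, e • x + y) ∈ G := by
  induction n generalizing y with
  | zero =>
    have : y = 0 := by simpa using hy
    exact ⟨0, zero_mem _, by simp [this, ← Prod.zero_eq_mk]⟩
  | succ n ih =>
    have hins : v '' Iio (n + 1) = insert (v n) (v '' Iio n) := by
      rw [← image_insert_eq]
      congr 1
      ext k
      simp
    rw [hins] at hy ⊢
    obtain ⟨a, z, hz, rfl⟩ := Submodule.mem_span_insert.1 hy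
    have hne : l n - e ≠ 0 := sub_ne_zero.2 (he n (by omega)).symm
    obtain ⟨t, ht, htG⟩ : ∃ t ∈ Submodule.span ℂ (v '' Iio n), (v n, l n • v n + t) ∈ G := by
      cases n with
      | zero => exact ⟨0, zero_mem _, by simpa using h0⟩
      | succ k =>
        exact ⟨b k • v k, Submodule.smul_mem _ _ (Submodule.subset_span ⟨k, by simp, rfl⟩), hs k⟩
    -- Back substitution: $(l_n-e)^{-1}a\,v_n$ produces $a\,v_n$ plus a multiple of $t$, which lies
    -- in the lower span and is compensated by the induction hypothesis.
    obtain ⟨x, hx, hxG⟩ := ih (fun k hk => he k (by omega)) (z - (a / (l n - e)) • t)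
      (sub_mem hz (Submodule.smul_mem _ _ ht))
    refine ⟨(a / (l n - e)) • v n + x, Submodule.mem_span_insert.2 ⟨_, x, hx, rfl⟩, ?_⟩
    convert G.add_mem (G.smul_mem (a / (l n - e)) htG) hxG using 1
    simp only [Prod.smul_mk, Prod.mk_add_mk, Prod.mk.injEq, true_and]
    have : a = a / (l n - e) * (l n - e) := by field_simp
    nth_rw 2 [this]
    module

/-- Eigenvectors of a triangular linear relation, with the same span. -/
lemma exists_eigenvectors_of_triangular {Y : Type*} [AddCommGroup Y] [Module ℂ Y]
    (G : Submodule ℂ (Y × Y)) (v : ℕ → Y) (l b : ℕ → ℂ) (hl : Function.Injective l)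
    (hv : LinearIndependent ℂ v)
    (h0 : (v 0, l 0 • v 0) ∈ G)
    (hs : ∀ k, (v (k + 1), l (k + 1) • v (k + 1) + b k • v k) ∈ G) :
    ∃ u : ℕ → Y, (∀ n, (u n, l n • u n) ∈ G) ∧ (∀ n, u n ≠ 0) ∧
      (∀ n, u n ∈ Submodule.span ℂ (range v)) ∧
      ∀ n, v n ∈ Submodule.span ℂ (range u) := by
  have key : ∀ n, ∃ x ∈ Submodule.span ℂ (v '' Iio n), (v n - x, l n • (v n - x)) ∈ G := by
    intro n
    obtain ⟨t, ht, htG⟩ : ∃ t ∈ Submodule.span ℂ (v '' Iio n), (v n, l n • v n + t) ∈ G := by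
      cases n with
      | zero => exact ⟨0, zero_mem _, by simpa using h0⟩
      | succ k =>
        exact ⟨b k • v k, Submodule.smul_mem _ _ (Submodule.subset_span ⟨k, by simp, rfl⟩), hs k⟩
    -- $G-l_n$ sends $v_n$ to $t$ in the lower span, where $l_n$ is not a diagonal entry, so a lower
    -- correction $x$ removes $t$. The change of basis is unitriangular, whence the equal spans.
    obtain ⟨x, hx, hxG⟩ := exists_solution_of_triangular G v l b h0 hs (l n) n
      (fun k hk => hl.ne (by omega)) t ht
    refine ⟨x, hx, ?_⟩
    convert G.sub_mem htG hxG using 1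
    simp only [Prod.mk_sub_mk, Prod.mk.injEq, true_and]
    module
  choose x hx hxG using key
  refine ⟨fun n => v n - x n, hxG, fun n hn => ?_, fun n => ?_, fun n => ?_⟩
  · refine hv.notMem_span_image (notMem_Iio.2 le_rfl : n ∉ Iio n) ?_
    rw [sub_eq_zero.1 hn]
    exact hx n
  · exact sub_mem (Submodule.subset_span ⟨n, rfl⟩)
      (Submodule.span_mono (image_subset_range _ _) (hx n))
  · induction n using Nat.strong_induction_on with
    | _ n ih =>
      have h1 : x n ∈ Submodule.span ℂ (range fun n => v n - x n) := by
        refine Submodule.span_le.2 ?_ (hx n)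
        rintro _ ⟨k, hk, rfl⟩
        exact ih k hk
      have h2 : v n - x n ∈ Submodule.span ℂ (range fun n => v n - x n) :=
        Submodule.subset_span ⟨n, rfl⟩
      simpa using add_mem h2 h1

end Abstract

/-! ### The connected components of the complement of the integers -/

/-- A connected subset of the line is order-connected, so leaving the unit interval would force it
through one of the endpoints, which are integers. -/
lemma connectedComponentIn_compl_range_intCast {γ : ℝ} (hγ : γ ∈ (range ((↑) : ℤ → ℝ))ᶜ) :
    connectedComponentIn (range ((↑) : ℤ → ℝ))ᶜ γ = Ioo (⌊γ⌋ : ℝ) ((⌊γ⌋ : ℝ) + 1) := by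
  have hlt : (⌊γ⌋ : ℝ) < γ := lt_of_le_of_ne (Int.floor_le γ) fun h => hγ ⟨_, h⟩
  apply Subset.antisymm
  · intro y hy
    have hpre : (connectedComponentIn (range ((↑) : ℤ → ℝ))ᶜ γ).OrdConnected :=
      isPreconnected_connectedComponentIn.ordConnected
    have hsub := connectedComponentIn_subset (range ((↑) : ℤ → ℝ))ᶜ γ
    have hmem := mem_connectedComponentIn hγ
    constructor
    · by_contra! h
      exact hsub (hpre.out hy hmem ⟨h, hlt.le⟩) ⟨_, rfl⟩
    · by_contra! h
      refine hsub (hpre.out hmem hy ⟨(Int.lt_floor_add_one γ).le, h⟩) ⟨⌊γ⌋ + 1, ?_⟩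
      push_cast
      rfl
  · refine isPreconnected_Ioo.subset_connectedComponentIn ⟨hlt, Int.lt_floor_add_one γ⟩ ?_
    rintro y ⟨h1, h2⟩ ⟨k, rfl⟩
    have h1' : ⌊γ⌋ < k := by exact_mod_cast h1
    have h2' : k < ⌊γ⌋ + 1 := by exact_mod_cast h2
    omega

lemma connectedComponentIn_image_compl_range_intCast :
    connectedComponentIn (range ((↑) : ℤ → ℝ))ᶜ '' (range ((↑) : ℤ → ℝ))ᶜ =
      range fun K : ℤ => Ioo (K : ℝ) ((K : ℝ) + 1) := by
  ext s
  constructor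
  · rintro ⟨γ, hγ, rfl⟩
    exact ⟨⌊γ⌋, (connectedComponentIn_compl_range_intCast hγ).symm⟩
  · rintro ⟨K, rfl⟩
    have hfl : ⌊(K : ℝ) + 1 / 2⌋ = K := by
      rw [Int.floor_eq_iff]
      constructor <;> linarith
    have hmem : (K : ℝ) + 1 / 2 ∈ (range ((↑) : ℤ → ℝ))ᶜ := by
      rintro ⟨m, hm⟩
      rw [← hm, Int.floor_intCast] at hfl
      subst hfl
      linarith
    refine ⟨_, hmem, ?_⟩
    rw [connectedComponentIn_compl_range_intCast hmem, hfl]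

lemma infinite_range_Ioo_intCast :
    (range fun K : ℤ => Ioo (K : ℝ) ((K : ℝ) + 1)).Infinite := by
  refine infinite_range_of_injective fun K L h => ?_
  have hK : (K : ℝ) < K + 1 := by linarith
  have hL : (L : ℝ) < L + 1 := by linarith
  have := congrArg sInf h
  simp only [csInf_Ioo hK, csInf_Ioo hL] at this
  exact_mod_cast this

/-! ### The differential algebra of smooth functions -/

lemma smooth_hasDerivAt (u : smoothFunctions) (x : ℝ) : HasDerivAt u.1 ((D u).1 x) x :=
  ((contDiff_infty_iff_deriv.1 u.2).1 x).hasDerivAt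

lemma smooth_continuous (u : smoothFunctions) : Continuous u.1 := (smooth_contDiff u).continuous

lemma D_eq_of_hasDerivAt {u v : smoothFunctions} (h : ∀ x, HasDerivAt u.1 (v.1 x) x) : D u = v :=
  Subtype.ext (funext fun x => (h x).deriv)

lemma D_mul (u v : smoothFunctions) : D (u * v) = D u * v + u * D v :=
  D_eq_of_hasDerivAt fun x => (smooth_hasDerivAt u x).mul (smooth_hasDerivAt v x)

lemma schrodingerExpr_apply (V u : smoothFunctions) :
    schrodingerExpr V u = -D (D u) + V * u := rfl

variable {c : ℝ}

lemma D_one : D 1 = 0 := D_eq_of_hasDerivAt fun x => hasDerivAt_const x (1 : ℂ)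

lemma D_coord : D (coord c) = 1 := by
  refine D_eq_of_hasDerivAt fun x => ?_
  exact (Complex.ofRealCLM.hasDerivAt (x := x)).sub_const _

lemma coord_mul_coordInv (hc : 0 < c) : coord c * coordInv hc = 1 :=
  Subtype.ext (funext fun x => mul_inv_cancel₀ (coord_ne_zero hc x))

lemma D_coordInv (hc : 0 < c) : D (coordInv hc) = -coordInv hc ^ 2 := by
  have h := congrArg D (coord_mul_coordInv hc)
  rw [D_mul, D_one, D_coord] at h
  linear_combination coordInv hc * h - D (coordInv hc) * coord_mul_coordInv hc

lemma D_superpotential (hc : 0 < c) (γ : ℝ) :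
    D (superpotential hc γ) = 1 + ((γ : ℂ) + 1 / 2) • coordInv hc ^ 2 := by
  rw [superpotential, map_sub, map_smul, D_coord, D_coordInv, smul_neg, sub_neg_eq_add]

lemma superpotential_sq (hc : 0 < c) (γ : ℝ) :
    superpotential hc γ ^ 2 = coord c ^ 2 - (2 * (γ : ℂ) + 1) • 1 +
      (((γ : ℂ) + 1 / 2) ^ 2) • coordInv hc ^ 2 := by
  have h : (2 * (γ : ℂ) + 1) • (1 : smoothFunctions) =
      (2 * ((γ : ℂ) + 1 / 2)) • (coord c * coordInv hc) := by
    rw [coord_mul_coordInv]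
    congr 1
    ring
  rw [h, superpotential]
  simp only [Algebra.smul_def, map_mul, map_pow, map_ofNat]
  ring

/-- The potential of $BA$ is $W^2-W'$: the coefficient of $r^{-2}$ is
$(\gamma+1/2)^2-(\gamma+1/2)=\gamma^2-1/4$ and the constant is $-(2\gamma+1)-1$. -/
lemma opB_mul_opA (hc : 0 < c) (γ : ℝ) : opB hc γ * opA hc γ = exprL hc γ := by
  refine LinearMap.ext fun u => ?_
  change -D (D u + superpotential hc γ * u) +
    superpotential hc γ * (D u + superpotential hc γ * u) =
    -D (D u) + oscPotential hc |γ| * u - (2 * (γ : ℂ) + 2) • u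
  have hsq : ((|γ| : ℝ) : ℂ) ^ 2 = (γ : ℂ) ^ 2 := by
    exact_mod_cast congrArg (Complex.ofReal) (sq_abs γ)
  have hV : superpotential hc γ ^ 2 - D (superpotential hc γ) =
      oscPotential hc |γ| - (2 * (γ : ℂ) + 2) • 1 := by
    rw [D_superpotential, superpotential_sq, oscPotential, hsq]
    module
  have hu := congrArg (· * u) hV
  simp only [sub_mul, smul_mul_assoc, one_mul] at hu
  rw [map_add, D_mul]
  linear_combination hu

/-- Here the potential is $W^2+W'$, with coefficient $(\gamma+1/2)^2+(\gamma+1/2)=(\gamma+1)^2-1/4$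
and constant $-(2\gamma+1)+1$. -/
lemma opA_mul_opB (hc : 0 < c) (γ : ℝ) : opA hc γ * opB hc γ = exprR hc γ := by
  refine LinearMap.ext fun u => ?_
  change D (-D u + superpotential hc γ * u) +
    superpotential hc γ * (-D u + superpotential hc γ * u) =
    -D (D u) + oscPotential hc |γ + 1| * u - (2 * (γ : ℂ)) • u
  have hsq : ((|γ + 1| : ℝ) : ℂ) ^ 2 = ((γ : ℂ) + 1) ^ 2 := by
    exact_mod_cast congrArg (Complex.ofReal) (sq_abs (γ + 1))
  have hV : superpotential hc γ ^ 2 + D (superpotential hc γ) =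
      oscPotential hc |γ + 1| - (2 * (γ : ℂ)) • 1 := by
    rw [D_superpotential, superpotential_sq, oscPotential, hsq]
    module
  have hu := congrArg (· * u) hV
  simp only [sub_mul, add_mul, smul_mul_assoc, one_mul] at hu
  rw [map_add, map_neg, D_mul]
  linear_combination hu

/-- Once the diagonal entries are $BA$ and $AB$, the commutators vanish by associativity:
$(AB)A=A(BA)$ and $(BA)B=B(AB)$. -/
theorem isSl11 (hc : 0 < c) (γ : ℝ) : IsSl11 (superG hc γ) (superQ hc γ) (superQt hc γ) := by
  constructor <;> ext1 i j <;> fin_cases i <;> fin_cases j <;>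
    simp [superG, superQ, superQt, ← opB_mul_opA, ← opA_mul_opB, mul_assoc]
  all_goals exact LinearMap.ext fun u => sub_self _

/-! ### Powers of `w = c + i x` -/

/-- The variable `w = i r = c + i x`, which stays in the right half-plane. -/
def rot (c : ℝ) (x : ℝ) : ℂ := c + x * Complex.I

lemma rot_re (c x : ℝ) : (rot c x).re = c := by simp [rot]

lemma rot_im (c x : ℝ) : (rot c x).im = x := by simp [rot]

lemma rot_mem_slitPlane (hc : 0 < c) (x : ℝ) : rot c x ∈ Complex.slitPlane :=
  Or.inl (by rwa [rot_re])

lemma rot_ne_zero (hc : 0 < c) (x : ℝ) : rot c x ≠ 0 :=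
  Complex.slitPlane_ne_zero (rot_mem_slitPlane hc x)

lemma contDiff_rot (c : ℝ) : ContDiff ℝ ∞ (rot c) :=
  contDiff_const.add (Complex.ofRealCLM.contDiff.mul contDiff_const)

lemma hasDerivAt_rot (c x : ℝ) : HasDerivAt (rot c) Complex.I x := by
  have h := ((Complex.ofRealCLM.hasDerivAt (x := x)).mul_const Complex.I).const_add (c : ℂ)
  rw [Complex.ofRealCLM_apply, Complex.ofReal_one, one_mul] at h
  exact h

/-- The function `w ^ m`. -/
def wpow (hc : 0 < c) (m : ℝ) : smoothFunctions :=
  ⟨fun x => rot c x ^ (m : ℂ), by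
    have h : (fun x => rot c x ^ (m : ℂ)) = fun x => Complex.exp (Complex.log (rot c x) * m) := by
      funext x
      rw [Complex.cpow_def_of_ne_zero (rot_ne_zero hc x)]
    change ContDiff ℝ ∞ fun x => rot c x ^ (m : ℂ)
    rw [h]
    refine ContDiff.cexp (ContDiff.mul ?_ contDiff_const)
    refine contDiff_iff_contDiffAt.2 fun x => ?_
    exact ((Complex.contDiffAt_log (n := ∞) (rot_mem_slitPlane hc x)).restrict_scalars ℝ).comp x
      (contDiff_rot c).contDiffAt⟩

lemma wpow_apply (hc : 0 < c) (m x : ℝ) : (wpow hc m).1 x = rot c x ^ (m : ℂ) := rfl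

lemma wpow_add (hc : 0 < c) (m n : ℝ) : wpow hc (m + n) = wpow hc m * wpow hc n := by
  refine Subtype.ext (funext fun x => ?_)
  change rot c x ^ ((m + n : ℝ) : ℂ) = rot c x ^ (m : ℂ) * rot c x ^ (n : ℂ)
  rw [Complex.ofReal_add, Complex.cpow_add _ _ (rot_ne_zero hc x)]

lemma wpow_zero (hc : 0 < c) : wpow hc 0 = 1 := by
  refine Subtype.ext (funext fun x => ?_)
  change rot c x ^ ((0 : ℝ) : ℂ) = 1
  simp

lemma D_wpow (hc : 0 < c) (m : ℝ) : D (wpow hc m) = (Complex.I * m) • wpow hc (m - 1) := by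
  refine D_eq_of_hasDerivAt fun x => ?_
  have h := ((Complex.hasStrictDerivAt_cpow_const (c := m) (rot_mem_slitPlane hc x)).hasDerivAt).comp x
    (hasDerivAt_rot c x)
  refine h.congr_deriv ?_
  change _ = Complex.I * m * rot c x ^ ((m - 1 : ℝ) : ℂ)
  push_cast
  ring

/-- The function `exp (w ^ 2 / 2)`. -/
def wgauss (c : ℝ) : smoothFunctions :=
  ⟨fun x => Complex.exp (rot c x ^ 2 / 2),
    show ContDiff ℝ ∞ fun x => Complex.exp (rot c x ^ 2 / 2) from
      (((contDiff_rot c).pow 2).div_const 2).cexp⟩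

lemma D_wgauss (hc : 0 < c) : D (wgauss c) = Complex.I • (wpow hc 1 * wgauss c) := by
  refine D_eq_of_hasDerivAt fun x => ?_
  have h := (((hasDerivAt_rot c x).pow 2).div_const 2).cexp
  refine h.congr_deriv ?_
  change _ = Complex.I * (rot c x ^ ((1 : ℝ) : ℂ) * Complex.exp (rot c x ^ 2 / 2))
  simp
  ring

/-- The function `w ^ m * exp (w ^ 2 / 2)`. -/
def wfun (hc : 0 < c) (m : ℝ) : smoothFunctions := wpow hc m * wgauss c

lemma wfun_apply (hc : 0 < c) (m x : ℝ) :
    (wfun hc m).1 x = rot c x ^ (m : ℂ) * Complex.exp (rot c x ^ 2 / 2) := rfl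

lemma wfun_ne_zero (hc : 0 < c) (m x : ℝ) : (wfun hc m).1 x ≠ 0 := by
  rw [wfun_apply]
  exact mul_ne_zero (by simp [Complex.cpow_eq_zero_iff, rot_ne_zero hc x]) (Complex.exp_ne_zero _)

lemma D_wfun (hc : 0 < c) (m : ℝ) :
    D (wfun hc m) = (Complex.I * m) • wfun hc (m - 1) + Complex.I • wfun hc (m + 1) := by
  rw [wfun, D_mul, D_wpow, D_wgauss hc, wfun, wfun, wpow_add]
  simp only [smul_mul_assoc, mul_smul_comm, mul_assoc]

lemma oscPotential_eq (hc : 0 < c) (ξ : ℝ) :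
    oscPotential hc ξ = (1 / 4 - (ξ : ℂ) ^ 2) • wpow hc (-2) - wpow hc 2 := by
  refine Subtype.ext (funext fun x => ?_)
  change ((ξ : ℂ) ^ 2 - 1 / 4) * ((x : ℂ) - Complex.I * c)⁻¹ ^ 2 + ((x : ℂ) - Complex.I * c) ^ 2 =
    (1 / 4 - (ξ : ℂ) ^ 2) * rot c x ^ (((-2 : ℝ)) : ℂ) - rot c x ^ ((2 : ℝ) : ℂ)
  have h1 : (x : ℂ) - Complex.I * c = -Complex.I * rot c x := by
    rw [rot]
    linear_combination (x : ℂ) * Complex.I_sq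
  have h2 : rot c x ^ (((-2 : ℝ)) : ℂ) = (rot c x ^ 2)⁻¹ := by
    have : (((-2 : ℝ)) : ℂ) = -((2 : ℕ) : ℂ) := by push_cast; rfl
    rw [this, Complex.cpow_neg, Complex.cpow_natCast]
  have h3 : rot c x ^ ((2 : ℝ) : ℂ) = rot c x ^ 2 := by
    have : ((2 : ℝ) : ℂ) = ((2 : ℕ) : ℂ) := by push_cast; rfl
    rw [this, Complex.cpow_natCast]
  rw [h1, h2, h3, inv_pow, mul_pow, neg_sq, Complex.I_sq, mul_inv]
  ring

/-- As $d/dx=i\,d/dw$, the kinetic term is $d^2/dw^2$. Its $w^{m+2}$ term from the Gaussian cancels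
against $r^2=-w^2$, and $m(m-1)+1/4=(m-1/2)^2$. The lower term vanishes for $m=1/2\pm\xi$, where a
ladder starts. -/
lemma schrodingerExpr_wfun (hc : 0 < c) (ξ m : ℝ) :
    schrodingerExpr (oscPotential hc ξ) (wfun hc m) =
      (2 * (m : ℂ) + 1) • wfun hc m + (((m : ℂ) - 1 / 2) ^ 2 - (ξ : ℂ) ^ 2) • wfun hc (m - 2) := by
  rw [schrodingerExpr_apply, D_wfun, map_add, map_smul, map_smul, D_wfun, D_wfun, oscPotential_eq,
    sub_mul, smul_mul_assoc]
  have h1 : wpow hc (-2) * wfun hc m = wfun hc (m - 2) := by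
    rw [wfun, ← mul_assoc, ← wpow_add, wfun]
    ring_nf
  have h2 : wpow hc 2 * wfun hc m = wfun hc (m + 2) := by
    rw [wfun, ← mul_assoc, ← wpow_add, wfun]
    ring_nf
  rw [h1, h2, show m - 1 - 1 = m - 2 by ring, show m - 1 + 1 = m by ring,
    show m + 1 - 1 = m by ring, show m + 1 + 1 = m + 2 by ring]
  simp only [smul_add, smul_smul, Complex.ofReal_sub, Complex.ofReal_add, Complex.ofReal_one]
  have hI := Complex.I_mul_I
  match_scalars
  · linear_combination (-(m : ℂ) * (m - 1)) * hI
  · linear_combination (-(m : ℂ) - (m + 1)) * hI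
  · linear_combination (-1 : ℂ) * hI

/-! ### Gaussian decay -/

/-- Bounded by a multiple of `exp (-x ^ 2 / 4)`. -/
def GaussianDecay (u : ℝ → ℂ) : Prop :=
  ∃ C : ℝ, ∀ x, ‖u x‖ ≤ C * Real.exp (-x ^ 2 / 4)

lemma GaussianDecay.memLp {u : ℝ → ℂ} (hu : GaussianDecay u) (hc : Continuous u) :
    MemLp u 2 volume := by
  obtain ⟨C, hC⟩ := hu
  rw [memLp_two_iff_integrable_sq_norm hc.aestronglyMeasurable]
  refine Integrable.mono' ((integrable_exp_neg_mul_sq (b := 1 / 2) (by norm_num)).const_mul (C ^ 2))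
    (hc.norm.pow 2).aestronglyMeasurable (Filter.Eventually.of_forall fun x => ?_)
  rw [Real.norm_of_nonneg (sq_nonneg _)]
  calc ‖u x‖ ^ 2 ≤ (C * Real.exp (-x ^ 2 / 4)) ^ 2 := pow_le_pow_left₀ (norm_nonneg _) (hC x) 2
    _ = C ^ 2 * Real.exp (-(1 / 2) * x ^ 2) := by
      rw [mul_pow, ← Real.exp_nat_mul]
      congr 2
      push_cast
      ring

lemma norm_rot (c x : ℝ) : ‖rot c x‖ = √(c ^ 2 + x ^ 2) := by
  rw [rot, Complex.norm_add_mul_I]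

lemma le_norm_rot (c x : ℝ) : c ≤ ‖rot c x‖ := by
  rw [norm_rot]
  exact Real.le_sqrt_of_sq_le (by nlinarith [sq_nonneg x])

lemma norm_rot_le (hc : 0 < c) (x : ℝ) : ‖rot c x‖ ≤ c + |x| := by
  rw [norm_rot]
  refine Real.sqrt_le_iff.2 ⟨by positivity, ?_⟩
  nlinarith [abs_nonneg x, sq_abs x]

lemma norm_wpow (hc : 0 < c) (m x : ℝ) : ‖(wpow hc m).1 x‖ = ‖rot c x‖ ^ m := by
  rw [wpow_apply, Complex.norm_cpow_real]

lemma norm_wgauss (c x : ℝ) :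
    ‖(wgauss c).1 x‖ = Real.exp (c ^ 2 / 2) * Real.exp (-x ^ 2 / 2) := by
  change ‖Complex.exp (rot c x ^ 2 / 2)‖ = _
  rw [Complex.norm_exp, ← Real.exp_add]
  congr 1
  have : rot c x ^ 2 / 2 = (((c ^ 2 - x ^ 2) / 2 : ℝ) : ℂ) + ((c * x : ℝ) : ℂ) * Complex.I := by
    rw [rot]
    push_cast
    linear_combination (x : ℂ) ^ 2 / 2 * Complex.I_sq
  rw [this, Complex.add_re, Complex.re_ofReal_mul, Complex.ofReal_re, Complex.I_re]
  ring

/-- The rate $1/8$ is a budget: $e^{-x^2/2}$ from the Gaussian absorbs one such factor for the power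
and one for a further factor, leaving $e^{-x^2/4}$. -/
lemma exists_norm_wpow_le (hc : 0 < c) (m : ℝ) :
    ∃ C : ℝ, ∀ x, ‖(wpow hc m).1 x‖ ≤ C * Real.exp (x ^ 2 / 8) := by
  rcases le_or_gt m 0 with hm | hm
  · refine ⟨c ^ m, fun x => ?_⟩
    rw [norm_wpow]
    have h1 : ‖rot c x‖ ^ m ≤ c ^ m :=
      Real.rpow_le_rpow_of_nonpos hc (le_norm_rot c x) hm
    have h2 : 1 ≤ Real.exp (x ^ 2 / 8) := Real.one_le_exp (by positivity)
    have h3 : 0 ≤ c ^ m := by positivity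
    nlinarith
  · refine ⟨(4 * m * Real.exp (c ^ 2 / (4 * m))) ^ (m / 2), fun x => ?_⟩
    rw [norm_wpow, norm_rot, Real.sqrt_eq_rpow, ← Real.rpow_mul (by positivity)]
    -- This is $y\le e^y$ with $y=(c^2+x^2)/(4m)$; the scale $4m$ is chosen so that the power $m/2$
    -- turns $x^2/(4m)$ into $x^2/8$.
    have h1 : c ^ 2 + x ^ 2 ≤ 4 * m * Real.exp (c ^ 2 / (4 * m)) * Real.exp (x ^ 2 / (4 * m)) := by
      rw [mul_assoc, ← Real.exp_add, ← add_div]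
      have := Real.add_one_le_exp ((c ^ 2 + x ^ 2) / (4 * m))
      calc c ^ 2 + x ^ 2 = 4 * m * ((c ^ 2 + x ^ 2) / (4 * m)) := by field_simp
        _ ≤ _ := mul_le_mul_of_nonneg_left (by linarith) (by positivity)
    calc (c ^ 2 + x ^ 2) ^ (1 / 2 * m)
        ≤ (4 * m * Real.exp (c ^ 2 / (4 * m)) * Real.exp (x ^ 2 / (4 * m))) ^ (1 / 2 * m) :=
          Real.rpow_le_rpow (by positivity) h1 (by positivity)
      _ = _ := by
        rw [Real.mul_rpow (by positivity) (by positivity), ← Real.exp_mul]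
        congr 2
        · ring
        · field_simp
          ring

lemma gaussianDecay_wfun_mul (hc : 0 < c) (m : ℝ) {g : ℝ → ℂ} {K : ℝ}
    (hg : ∀ x, ‖g x‖ ≤ K * Real.exp (x ^ 2 / 8)) :
    GaussianDecay fun x => (wfun hc m).1 x * g x := by
  obtain ⟨C, hC⟩ := exists_norm_wpow_le hc m
  refine ⟨C * K * Real.exp (c ^ 2 / 2), fun x => ?_⟩
  change ‖(wpow hc m).1 x * (wgauss c).1 x * g x‖ ≤ _
  rw [norm_mul, norm_mul, norm_wgauss]
  have h1 := mul_le_mul (hC x) (hg x) (norm_nonneg _) ((norm_nonneg _).trans (hC x))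
  have h2 : Real.exp (-x ^ 2 / 4) =
      Real.exp (x ^ 2 / 8) * Real.exp (x ^ 2 / 8) * Real.exp (-x ^ 2 / 2) := by
    rw [← Real.exp_add, ← Real.exp_add]
    congr 1
    ring
  rw [h2]
  have h3 := mul_le_mul_of_nonneg_right h1
    (by positivity : 0 ≤ Real.exp (c ^ 2 / 2) * Real.exp (-x ^ 2 / 2))
  linarith

lemma gaussianDecay_wfun (hc : 0 < c) (m : ℝ) : GaussianDecay (wfun hc m).1 := by
  have := gaussianDecay_wfun_mul hc m (g := fun _ => 1) (K := 1) fun x => by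
    rw [norm_one, one_mul]
    exact Real.one_le_exp (by positivity)
  simpa using this

lemma memLp_wfun (hc : 0 < c) (m : ℝ) : MemLp (wfun hc m).1 2 volume :=
  (gaussianDecay_wfun hc m).memLp (smooth_continuous _)

lemma memLp_D_wfun (hc : 0 < c) (m : ℝ) : MemLp (D (wfun hc m)).1 2 volume := by
  rw [D_wfun]
  exact ((memLp_wfun hc _).const_smul _).add ((memLp_wfun hc _).const_smul _)

/-! ### Integration by parts -/

lemma integral_D_eq_zero (u : smoothFunctions) (hu : HasCompactSupport u.1) :
    ∫ x, (D u).1 x = 0 :=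
  integral_eq_zero_of_hasDerivAt_of_integrable (smooth_hasDerivAt u)
    ((smooth_continuous (D u)).integrable_of_hasCompactSupport hu.deriv)
    ((smooth_continuous u).integrable_of_hasCompactSupport hu)

/-- Lagrange's identity: $u\,H\varphi-(Hu)\varphi=(u'\varphi-u\varphi')'$. The pairing is bilinear,
without conjugation, so the complex potential does no harm. -/
lemma integral_mul_schrodingerExpr (V u φ : smoothFunctions) (hφ : HasCompactSupport φ.1) :
    ∫ x, u.1 x * (schrodingerExpr V φ).1 x = ∫ x, (schrodingerExpr V u).1 x * φ.1 x := by
  have hφ' : HasCompactSupport (D φ).1 := hφ.deriv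
  have hc : HasCompactSupport (D u * φ - u * D φ).1 :=
    (hφ.mul_left (f := (D u).1)).sub (hφ'.mul_left (f := u.1))
  have h := integral_D_eq_zero _ hc
  have hD : D (D u * φ - u * D φ) = u * schrodingerExpr V φ - schrodingerExpr V u * φ := by
    rw [map_sub, D_mul, D_mul, schrodingerExpr_apply, schrodingerExpr_apply]
    ring
  rw [hD] at h
  have h1 : Integrable fun x => u.1 x * (schrodingerExpr V φ).1 x :=
    (smooth_continuous (u * schrodingerExpr V φ)).integrable_of_hasCompactSupport
      ((compact_schrodingerExpr V φ hφ).mul_left (f := u.1))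
  have h2 : Integrable fun x => (schrodingerExpr V u).1 x * φ.1 x :=
    (smooth_continuous (schrodingerExpr V u * φ)).integrable_of_hasCompactSupport
      (hφ.mul_left (f := (schrodingerExpr V u).1))
  rw [← sub_eq_zero, ← integral_sub h1 h2]
  exact h

/-- Smooth functions in the domain of the maximal realization. -/
lemma toLp_mem_schrodingerGraph (V u h : smoothFunctions) (hu : MemLp u.1 2 volume)
    (hh : MemLp h.1 2 volume) (huh : schrodingerExpr V u = h) :
    ((hu.toLp u.1, hh.toLp h.1) : L2R × L2R) ∈ schrodingerGraph V := by
  intro φ hφ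
  have h1 : ∫ x, (hu.toLp u.1) x * (schrodingerExpr V φ).1 x =
      ∫ x, u.1 x * (schrodingerExpr V φ).1 x := by
    refine integral_congr_ae ?_
    filter_upwards [hu.coeFn_toLp] with x hx
    rw [hx]
  have h2 : ∫ x, (hh.toLp h.1) x * φ.1 x = ∫ x, h.1 x * φ.1 x := by
    refine integral_congr_ae ?_
    filter_upwards [hh.coeFn_toLp] with x hx
    rw [hx]
  change ∫ x, (hu.toLp u.1) x * (schrodingerExpr V φ).1 x = ∫ x, (hh.toLp h.1) x * φ.1 x
  rw [h1, h2, integral_mul_schrodingerExpr V u φ hφ, huh]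

/-- The smooth cut-off function `x ↦ χ (x / (n + 1))`. -/
def cutoff (n : ℕ) : smoothFunctions :=
  ⟨fun x => (((⟨1, 2, one_pos, one_lt_two⟩ : ContDiffBump (0 : ℝ)) (x / (n + 1)) : ℝ) : ℂ),
    show ContDiff ℝ ∞ fun x : ℝ =>
      (((⟨1, 2, one_pos, one_lt_two⟩ : ContDiffBump (0 : ℝ)) (x / (n + 1)) : ℝ) : ℂ) from
    Complex.ofRealCLM.contDiff.comp ((ContDiffBump.contDiff _).comp
      (contDiff_id.div_const _))⟩

lemma norm_cutoff_le (n : ℕ) (x : ℝ) : ‖(cutoff n).1 x‖ ≤ 1 := by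
  change ‖((_ : ℝ) : ℂ)‖ ≤ 1
  rw [Complex.norm_real, Real.norm_of_nonneg (ContDiffBump.nonneg _)]
  exact ContDiffBump.le_one _

lemma cutoff_eq_one {n : ℕ} {x : ℝ} (h : |x| ≤ n + 1) : (cutoff n).1 x = 1 := by
  change ((_ : ℝ) : ℂ) = 1
  rw [ContDiffBump.one_of_mem_closedBall]
  · simp
  · rw [mem_closedBall_zero_iff, norm_div, Real.norm_eq_abs, Real.norm_eq_abs,
      abs_of_pos (by positivity : (0 : ℝ) < n + 1)]
    exact (div_le_one (by positivity)).2 h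

lemma cutoff_eventuallyEq (x : ℝ) :
    ∀ᶠ n : ℕ in Filter.atTop, (cutoff n).1 =ᶠ[nhds x] fun _ => 1 := by
  obtain ⟨N, hN⟩ := exists_nat_gt |x|
  filter_upwards [Filter.eventually_ge_atTop N] with n hn
  have h : ∀ᶠ y : ℝ in nhds x, |y| < N := continuous_abs.continuousAt.eventually (gt_mem_nhds hN)
  filter_upwards [h] with y hy
  refine cutoff_eq_one ?_
  have : (N : ℝ) ≤ n := by exact_mod_cast hn
  linarith

lemma hasCompactSupport_cutoff (n : ℕ) : HasCompactSupport (cutoff n).1 := by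
  have h := (⟨1, 2, one_pos, one_lt_two⟩ : ContDiffBump (0 : ℝ)).hasCompactSupport
  have h2 := h.comp_homeomorph (Homeomorph.mulRight₀ ((n + 1 : ℝ)⁻¹) (by positivity))
  exact h2.comp_left (g := fun y : ℝ => (y : ℂ)) (by simp)

/-- Each derivative of the rescaled bump gains a factor $1/(n+1)\le1$, so the derivatives of the
cut-offs are bounded uniformly in $n$. -/
lemma D_cutoff_apply (n : ℕ) (x : ℝ) :
    (D (cutoff n)).1 x = ((n + 1 : ℝ)⁻¹ : ℝ) • (D (cutoff 0)).1 (x / (n + 1)) := by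
  have h0 : ∀ y, (cutoff n).1 y = (cutoff 0).1 (y / (n + 1)) := by
    intro y
    change ((ContDiffBump.toFun _ _ : ℝ) : ℂ) = ((ContDiffBump.toFun _ _ : ℝ) : ℂ)
    simp
  have h1 := (smooth_hasDerivAt (cutoff 0) (x / (n + 1))).scomp x
    ((hasDerivAt_id x).div_const ((n : ℝ) + 1))
  have h2 : HasDerivAt (cutoff n).1 _ x := h1.congr_of_eventuallyEq
    (Filter.Eventually.of_forall h0)
  rw [(smooth_hasDerivAt (cutoff n) x).unique h2, one_div]

lemma D_D_cutoff_apply (n : ℕ) (x : ℝ) :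
    (D (D (cutoff n))).1 x =
      ((n + 1 : ℝ)⁻¹ : ℝ) • ((n + 1 : ℝ)⁻¹ : ℝ) • (D (D (cutoff 0))).1 (x / (n + 1)) := by
  have h1 := ((smooth_hasDerivAt (D (cutoff 0)) (x / (n + 1))).scomp x
    ((hasDerivAt_id x).div_const ((n : ℝ) + 1))).const_smul ((n + 1 : ℝ)⁻¹ : ℝ)
  have h2 : HasDerivAt (D (cutoff n)).1 _ x := h1.congr_of_eventuallyEq
    (Filter.Eventually.of_forall fun y => D_cutoff_apply n y)
  rw [(smooth_hasDerivAt (D (cutoff n)) x).unique h2, one_div]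

lemma exists_bound_of_hasCompactSupport (u : smoothFunctions) (hu : HasCompactSupport u.1) :
    ∃ C, ∀ x, ‖u.1 x‖ ≤ C :=
  hu.exists_bound_of_continuous (smooth_continuous u)

lemma exists_norm_D_cutoff_le : ∃ C, ∀ n x, ‖(D (cutoff n)).1 x‖ ≤ C := by
  obtain ⟨C, hC⟩ := exists_bound_of_hasCompactSupport (D (cutoff 0))
    (hasCompactSupport_cutoff 0).deriv
  refine ⟨C, fun n x => ?_⟩
  rw [D_cutoff_apply, norm_smul, Real.norm_of_nonneg (by positivity)]
  have h : ((n + 1 : ℝ)⁻¹ : ℝ) ≤ 1 := inv_le_one_of_one_le₀ (by linarith [n.cast_nonneg (α := ℝ)])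
  exact (mul_le_of_le_one_left (norm_nonneg _) h).trans (hC _)

lemma exists_norm_D_D_cutoff_le : ∃ C, ∀ n x, ‖(D (D (cutoff n))).1 x‖ ≤ C := by
  obtain ⟨C, hC⟩ := exists_bound_of_hasCompactSupport (D (D (cutoff 0)))
    (hasCompactSupport_cutoff 0).deriv.deriv
  refine ⟨C, fun n x => ?_⟩
  rw [D_D_cutoff_apply, norm_smul, norm_smul, Real.norm_of_nonneg (by positivity)]
  have h : ((n + 1 : ℝ)⁻¹ : ℝ) ≤ 1 := inv_le_one_of_one_le₀ (by linarith [n.cast_nonneg (α := ℝ)])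
  have h' : (0 : ℝ) ≤ (n + 1 : ℝ)⁻¹ := by positivity
  exact (mul_le_of_le_one_left (by positivity) h).trans
    ((mul_le_of_le_one_left (norm_nonneg _) h).trans (hC _))

/-- The transposed equation holds against smooth functions which need not have compact
support. -/
lemma integral_mul_schrodingerExpr_of_mem_graph {V : smoothFunctions} {p : L2R × L2R}
    (hp : p ∈ schrodingerGraph V) (u : smoothFunctions) (hu : MemLp u.1 2 volume)
    (hu' : MemLp (D u).1 2 volume) (hu'' : MemLp (schrodingerExpr V u).1 2 volume) :
    ∫ x, p.1 x * (schrodingerExpr V u).1 x = ∫ x, p.2 x * u.1 x := by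
  obtain ⟨C₁, hC₁⟩ := exists_norm_D_cutoff_le
  obtain ⟨C₂, hC₂⟩ := exists_norm_D_D_cutoff_le
  have hexp : ∀ n, schrodingerExpr V (cutoff n * u) = cutoff n * schrodingerExpr V u -
      2 * (D (cutoff n) * D u) - D (D (cutoff n)) * u := by
    intro n
    rw [schrodingerExpr_apply, schrodingerExpr_apply, D_mul, map_add, D_mul, D_mul]
    ring
  have happ : ∀ n x, (schrodingerExpr V (cutoff n * u)).1 x =
      (cutoff n).1 x * (schrodingerExpr V u).1 x - 2 * ((D (cutoff n)).1 x * (D u).1 x) -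
        (D (D (cutoff n))).1 x * u.1 x := by
    intro n x
    rw [hexp]
    rfl
  have hint : ∀ (f : L2R) (v : ℝ → ℂ), MemLp v 2 volume → Integrable fun x => ‖f x‖ * ‖v x‖ :=
    fun f v hv => (Lp.memLp f).norm.integrable_mul hv.norm
  -- Near a given point the cut-offs are eventually identically $1$, so the Leibniz error terms
  -- vanish pointwise in the limit; dominated convergence does the rest.
  have hev : ∀ x, ∀ᶠ n : ℕ in Filter.atTop, (cutoff n).1 x = 1 ∧ (D (cutoff n)).1 x = 0 ∧
      (D (D (cutoff n))).1 x = 0 := by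
    intro x
    filter_upwards [cutoff_eventuallyEq x] with n hn
    have h1 : (D (cutoff n)).1 =ᶠ[nhds x] fun _ => 0 := by
      have := hn.deriv
      rwa [deriv_const'] at this
    have h2 : (D (D (cutoff n))).1 x = 0 := by
      have := h1.deriv
      rw [deriv_const'] at this
      exact this.eq_of_nhds
    exact ⟨hn.eq_of_nhds, h1.eq_of_nhds, h2⟩
  have hL : Filter.Tendsto (fun n : ℕ => ∫ x, p.1 x * (schrodingerExpr V (cutoff n * u)).1 x)
      Filter.atTop (nhds (∫ x, p.1 x * (schrodingerExpr V u).1 x)) := by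
    refine tendsto_integral_of_dominated_convergence (fun x => ‖p.1 x‖ * ‖(schrodingerExpr V u).1 x‖ +
      2 * C₁ * (‖p.1 x‖ * ‖(D u).1 x‖) + C₂ * (‖p.1 x‖ * ‖u.1 x‖)) (fun n => ?_) ?_ (fun n => ?_) ?_
    · exact (Lp.aestronglyMeasurable p.1).mul (smooth_continuous _).aestronglyMeasurable
    · exact ((hint _ _ hu'').add ((hint _ _ hu').const_mul _)).add ((hint _ _ hu).const_mul _)
    · refine Filter.Eventually.of_forall fun x => ?_
      rw [happ, norm_mul]
      have h1 : ‖(cutoff n).1 x * (schrodingerExpr V u).1 x - 2 * ((D (cutoff n)).1 x * (D u).1 x) -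
          (D (D (cutoff n))).1 x * u.1 x‖ ≤
          ‖(schrodingerExpr V u).1 x‖ + 2 * (C₁ * ‖(D u).1 x‖) + C₂ * ‖u.1 x‖ := by
        refine (norm_sub_le _ _).trans (add_le_add ((norm_sub_le _ _).trans (add_le_add ?_ ?_)) ?_)
        · rw [norm_mul]
          exact mul_le_of_le_one_left (norm_nonneg _) (norm_cutoff_le n x)
        · rw [norm_mul, norm_mul, Complex.norm_two]
          exact mul_le_mul_of_nonneg_left
            (mul_le_mul_of_nonneg_right (hC₁ n x) (norm_nonneg _)) zero_le_two
        · rw [norm_mul]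
          exact mul_le_mul_of_nonneg_right (hC₂ n x) (norm_nonneg _)
      refine (mul_le_mul_of_nonneg_left h1 (norm_nonneg _)).trans (le_of_eq ?_)
      ring
    · refine Filter.Eventually.of_forall fun x => ?_
      refine tendsto_const_nhds.congr' ?_
      filter_upwards [hev x] with n hn
      rw [happ, hn.1, hn.2.1, hn.2.2]
      ring
  have hR : Filter.Tendsto (fun n : ℕ => ∫ x, p.2 x * (cutoff n * u).1 x)
      Filter.atTop (nhds (∫ x, p.2 x * u.1 x)) := by
    refine tendsto_integral_of_dominated_convergence (fun x => ‖p.2 x‖ * ‖u.1 x‖)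
      (fun n => ?_) (hint _ _ hu) (fun n => ?_) ?_
    · exact (Lp.aestronglyMeasurable p.2).mul (smooth_continuous _).aestronglyMeasurable
    · refine Filter.Eventually.of_forall fun x => ?_
      change ‖p.2 x * ((cutoff n).1 x * u.1 x)‖ ≤ _
      rw [norm_mul, norm_mul]
      exact mul_le_mul_of_nonneg_left
        (mul_le_of_le_one_left (norm_nonneg _) (norm_cutoff_le n x)) (norm_nonneg _)
    · refine Filter.Eventually.of_forall fun x => ?_
      refine tendsto_const_nhds.congr' ?_
      filter_upwards [hev x] with n hn
      change _ = p.2 x * ((cutoff n).1 x * u.1 x)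
      rw [hn.1, one_mul]
  refine tendsto_nhds_unique (hL.congr fun n => ?_) hR
  exact hp (cutoff n * u) ((hasCompactSupport_cutoff n).mul_right (f' := u.1))

/-! ### Finite-dimensional eigenspaces -/

/-- The primitive of a smooth function vanishing at the origin. -/
def primitive (g : smoothFunctions) : smoothFunctions :=
  ⟨fun x => ∫ t in (0 : ℝ)..x, g.1 t, by
    have h : ∀ x, HasDerivAt (fun x => ∫ t in (0 : ℝ)..x, g.1 t) (g.1 x) x := fun x =>
      intervalIntegral.integral_hasDerivAt_right ((smooth_continuous g).intervalIntegrable _ _)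
        ((smooth_continuous g).stronglyMeasurableAtFilter _ _) (smooth_continuous g).continuousAt
    change ContDiff ℝ ∞ fun x => ∫ t in (0 : ℝ)..x, g.1 t
    refine contDiff_infty_iff_deriv.2 ⟨fun x => (h x).differentiableAt, ?_⟩
    rw [funext fun x => (h x).deriv]
    exact g.2⟩

lemma D_primitive (g : smoothFunctions) : D (primitive g) = g :=
  D_eq_of_hasDerivAt fun _ =>
    intervalIntegral.integral_hasDerivAt_right ((smooth_continuous g).intervalIntegrable _ _)
      ((smooth_continuous g).stronglyMeasurableAtFilter _ _) (smooth_continuous g).continuousAt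

lemma exists_primitive_hasCompactSupport (θ : smoothFunctions) (hθ : HasCompactSupport θ.1)
    (h0 : ∫ x, θ.1 x = 0) : ∃ Θ : smoothFunctions, HasCompactSupport Θ.1 ∧ D Θ = θ := by
  obtain ⟨R, hR⟩ := hθ.isCompact.isBounded.subset_closedBall (0 : ℝ)
  have hz : ∀ x, R < |x| → θ.1 x = 0 := by
    intro x hx
    by_contra h
    have := hR (subset_tsupport _ h)
    rw [mem_closedBall_zero_iff, Real.norm_eq_abs] at this
    linarith
  -- Normalized to vanish to the right of the support; the zero integral makes it vanish to the left
  -- too. The absolute value is needed since $R$ may be negative.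
  refine ⟨primitive θ - (∫ t in (0 : ℝ)..|R|, θ.1 t) • 1, ?_, ?_⟩
  · refine HasCompactSupport.intro (isCompact_Icc (a := -|R|) (b := |R|)) fun x hx => ?_
    change (∫ t in (0 : ℝ)..x, θ.1 t) - (∫ t in (0 : ℝ)..|R|, θ.1 t) * 1 = 0
    rw [mul_one, intervalIntegral.integral_interval_sub_left
      ((smooth_continuous θ).intervalIntegrable _ _)
      ((smooth_continuous θ).intervalIntegrable _ _)]
    have hRR := le_abs_self R
    by_cases hx' : |R| < x
    · refine intervalIntegral.integral_zero_ae (Filter.Eventually.of_forall fun t ht => ?_)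
      rw [uIoc_of_le hx'.le] at ht
      exact hz t (by linarith [ht.1, le_abs_self t])
    · have hx2 : x < -|R| := by
        by_contra! h
        exact hx ⟨h, not_lt.1 hx'⟩
      rw [intervalIntegral.integral_symm, intervalIntegral.integral_eq_integral_of_support_subset,
        h0, neg_zero]
      intro t ht
      by_contra h
      refine ht (hz t ?_)
      rw [mem_Ioc, not_and_or, not_lt, not_le] at h
      rcases h with h | h
      · linarith [neg_abs_le t]
      · linarith [le_abs_self t]
  · rw [map_sub, D_primitive, map_smul, D_one, smul_zero, sub_zero]

/-- The inverse of a nowhere vanishing smooth function. -/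
def smoothInv (u : smoothFunctions) (hu : ∀ x, u.1 x ≠ 0) : smoothFunctions :=
  ⟨fun x => (u.1 x)⁻¹, show ContDiff ℝ ∞ fun x => (u.1 x)⁻¹ from (smooth_contDiff u).inv hu⟩

lemma mul_smoothInv (u : smoothFunctions) (hu : ∀ x, u.1 x ≠ 0) : u * smoothInv u hu = 1 :=
  Subtype.ext (funext fun x => mul_inv_cancel₀ (hu x))

/-- Reduction of order: the correction is $(u^2g')'/u$. It serves both to bound the eigenspaces and
to build the Jordan chain. -/
lemma schrodingerExpr_mul_of_eigen {V u : smoothFunctions} {E : ℂ}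
    (hE : schrodingerExpr V u = E • u) (g : smoothFunctions) :
    schrodingerExpr V (u * g) = E • (u * g) - (2 * (D u * D g) + u * D (D g)) := by
  rw [schrodingerExpr_apply] at hE
  rw [schrodingerExpr_apply, ← smul_mul_assoc, ← hE, D_mul, map_add, D_mul, D_mul]
  ring

/-- The space of test functions. -/
def testFunctions : Submodule ℂ smoothFunctions where
  carrier := {φ | HasCompactSupport φ.1}
  zero_mem' := HasCompactSupport.zero
  add_mem' {φ ψ} (hφ : HasCompactSupport φ.1) (hψ : HasCompactSupport ψ.1) := hφ.add hψ
  smul_mem' a φ (hφ : HasCompactSupport φ.1) :=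
    hφ.mul_left (f := fun _ => a)

/-- The functional `φ ↦ ∫ g φ` on test functions, for smooth `g`. -/
def smoothFunctional (g : smoothFunctions) : testFunctions →ₗ[ℂ] ℂ where
  toFun φ := ∫ x, (g * φ.1).1 x
  map_add' φ ψ := by
    have h : ∀ φ : testFunctions, Integrable (g * φ.1).1 := fun φ =>
      (smooth_continuous _).integrable_of_hasCompactSupport
        (HasCompactSupport.mul_left (f := g.1) φ.2)
    rw [← integral_add (h φ) (h ψ)]
    refine integral_congr_ae (Filter.Eventually.of_forall fun x => ?_)
    exact mul_add (g.1 x) _ _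
  map_smul' a φ := by
    rw [RingHom.id_apply, smul_eq_mul, ← integral_const_mul]
    refine integral_congr_ae (Filter.Eventually.of_forall fun x => ?_)
    exact mul_left_comm (g.1 x) a _

/-- The pairing `(f, φ) ↦ ∫ f g φ` of `L²` with the test functions. -/
def weightedPairing (g : smoothFunctions) : L2R →ₗ[ℂ] testFunctions →ₗ[ℂ] ℂ :=
  have hint : ∀ (f : L2R) (φ : testFunctions), Integrable fun x => f x * (g * φ.1).1 x :=
    fun f φ => integrable_mul_of_compact f (g * φ.1) (HasCompactSupport.mul_left (f := g.1) φ.2)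
  LinearMap.mk₂ ℂ (fun f φ => ∫ x, f x * (g * φ.1).1 x)
    (fun f₁ f₂ φ => by
      rw [← integral_add (hint f₁ φ) (hint f₂ φ)]
      refine integral_congr_ae ?_
      filter_upwards [Lp.coeFn_add f₁ f₂] with x hx
      rw [hx, Pi.add_apply, add_mul])
    (fun a f φ => by
      rw [smul_eq_mul, ← integral_const_mul]
      refine integral_congr_ae ?_
      filter_upwards [Lp.coeFn_smul a f] with x hx
      rw [hx, Pi.smul_apply, smul_eq_mul, mul_assoc])
    (fun f φ ψ => by
      rw [← integral_add (hint f φ) (hint f ψ)]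
      refine integral_congr_ae (Filter.Eventually.of_forall fun x => ?_)
      change f x * (g.1 x * (φ.1.1 x + ψ.1.1 x)) = f x * (g.1 x * φ.1.1 x) + f x * (g.1 x * ψ.1.1 x)
      ring)
    (fun a f φ => by
      rw [smul_eq_mul, ← integral_const_mul]
      refine integral_congr_ae (Filter.Eventually.of_forall fun x => ?_)
      change f x * (g.1 x * (a * φ.1.1 x)) = a * (f x * (g.1 x * φ.1.1 x))
      ring)

lemma weightedPairing_apply (g : smoothFunctions) (f : L2R) (φ : testFunctions) :
    weightedPairing g f φ = ∫ x, f x * (g * φ.1).1 x := rfl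

/-- The hypothesis says that $(0,f)$ lies in the graph for $V=0$, and graphs are single-valued. -/
lemma eq_zero_of_integral_test_eq_zero (f : L2R)
    (h : ∀ φ : smoothFunctions, HasCompactSupport φ.1 → ∫ x, f x * φ.1 x = 0) : f = 0 :=
  schrodingerGraph_single_valued 0 (0, f) (fun φ hφ => by
    rw [h φ hφ]
    have : ∫ x, (0 : L2R) x * (schrodingerExpr 0 φ).1 x = 0 := by simp
    exact this) rfl

lemma mem_eigenspace_schrodingerOp (V : smoothFunctions) (E : ℂ) (f : L2R) :
    f ∈ eigenspace (schrodingerOp V) E ↔ (f, E • f) ∈ schrodingerGraph V := by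
  rw [mem_eigenspace_iff, schrodingerOp_graph]

lemma mem_span_range_of_forall_eq_zero {Y : Type*} [AddCommGroup Y] [Module ℂ Y]
    (L : Fin 2 → Y →ₗ[ℂ] ℂ) (K : Y →ₗ[ℂ] ℂ) (h : ∀ φ, L 0 φ = 0 → L 1 φ = 0 → K φ = 0) :
    K ∈ Submodule.span ℂ (range L) := by
  refine mem_span_of_iInf_ker_le_ker fun φ hφ => ?_
  rw [Submodule.mem_iInf] at hφ
  exact h φ (hφ 0) (hφ 1)

/-- Formally $(u^2(f/u)')'=0$, so $f/u$ is a combination of $1$ and $\int u^{-2}$. Weakly: if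
$\theta$ is orthogonal to both, then $\theta=(u^2\eta')'$ for a test function $\eta$, and testing
the equation for $f$ with $u\eta$ gives $\int f\theta/u=0$. -/
lemma weightedPairing_mem_span {V u : smoothFunctions} {E : ℂ} (hu : ∀ x, u.1 x ≠ 0)
    (hE : schrodingerExpr V u = E • u) {f : L2R} (hf : (f, E • f) ∈ schrodingerGraph V) :
    weightedPairing (smoothInv u hu) f ∈ Submodule.span ℂ (range
      ![smoothFunctional 1, smoothFunctional (primitive (smoothInv u hu ^ 2))]) := by
  refine mem_span_range_of_forall_eq_zero (Y := testFunctions) _ _ fun θ h1 h2 => ?_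
  change ∫ x, (1 * θ.1).1 x = 0 at h1
  change ∫ x, (primitive (smoothInv u hu ^ 2) * θ.1).1 x = 0 at h2
  rw [one_mul] at h1
  set v := smoothInv u hu with hv
  have huv : u * v = 1 := mul_smoothInv u hu
  obtain ⟨Θ, hΘ, hDΘ⟩ := exists_primitive_hasCompactSupport θ.1 θ.2 h1
  have hvΘ : HasCompactSupport (v ^ 2 * Θ).1 := hΘ.mul_left (f := (v ^ 2).1)
  -- Integration by parts moves the derivative from the primitive of $u^{-2}$ to $\Theta$; this is
  -- where the second orthogonality is used.
  have h3 : ∫ x, (v ^ 2 * Θ).1 x = 0 := by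
    have h4 := integral_D_eq_zero (primitive (v ^ 2) * Θ)
      (hΘ.mul_left (f := (primitive (v ^ 2)).1))
    rw [D_mul, D_primitive, hDΘ] at h4
    have hi1 : Integrable (v ^ 2 * Θ).1 :=
      (smooth_continuous _).integrable_of_hasCompactSupport hvΘ
    have hi2 : Integrable (primitive (v ^ 2) * θ.1).1 :=
      (smooth_continuous _).integrable_of_hasCompactSupport
        (HasCompactSupport.mul_left (f := (primitive (v ^ 2)).1) θ.2)
    have h5 := integral_add hi1 hi2
    rw [h2, add_zero] at h5
    rw [← h5]
    exact h4
  obtain ⟨η, hη, hDη⟩ := exists_primitive_hasCompactSupport _ hvΘ h3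
  have hkey : schrodingerExpr V (u * η) = E • (u * η) - v * θ.1 := by
    rw [schrodingerExpr_mul_of_eigen hE]
    have h6 : Θ = u ^ 2 * D η := by
      rw [hDη]
      linear_combination (-(u * v + 1) * Θ) * huv
    have h7 : θ.1 = 2 * (u * D u * D η) + u ^ 2 * D (D η) := by
      rw [← hDΘ, h6, D_mul, pow_two, D_mul]
      ring
    rw [h7]
    linear_combination (2 * D u * D η + u * D (D η)) * huv
  have hφ : HasCompactSupport (u * η).1 := hη.mul_left (f := u.1)
  have h8 := hf (u * η) hφ
  rw [hkey] at h8
  have hiv : HasCompactSupport (v * θ.1).1 := HasCompactSupport.mul_left (f := v.1) θ.2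
  have h9 : ∫ x, f x * (E • (u * η) - v * θ.1).1 x =
      E * (∫ x, f x * (u * η).1 x) - ∫ x, f x * (v * θ.1).1 x := by
    rw [← integral_const_mul, ← integral_sub ((integrable_mul_of_compact f _ hφ).const_mul E)
      (integrable_mul_of_compact f _ hiv)]
    refine integral_congr_ae (Filter.Eventually.of_forall fun x => ?_)
    change f x * (E * (u * η).1 x - (v * θ.1).1 x) = _
    ring
  have h10 : ∫ x, (E • f) x * (u * η).1 x = E * ∫ x, f x * (u * η).1 x := by
    rw [← integral_const_mul]
    refine integral_congr_ae ?_
    filter_upwards [Lp.coeFn_smul E f] with x hx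
    rw [hx, Pi.smul_apply, smul_eq_mul, mul_assoc]
  have h11 : E * (∫ x, f x * (u * η).1 x) - ∫ x, f x * (v * θ.1).1 x =
      E * ∫ x, f x * (u * η).1 x := by
    rw [← h9, ← h10]
    exact h8
  rw [weightedPairing_apply]
  linear_combination -h11

/-- The map $f\mapsto f/u$ sends the eigenspace into the span of two functionals, and is injective
because test functions $u\varphi$ recover $\int f\varphi$. -/
lemma finiteDimensional_eigenspace {V u : smoothFunctions} {E : ℂ} (hu : ∀ x, u.1 x ≠ 0)
    (hE : schrodingerExpr V u = E • u) :
    FiniteDimensional ℂ (eigenspace (schrodingerOp V) E) := by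
  let S := Submodule.span ℂ (range
    ![smoothFunctional 1, smoothFunctional (primitive (smoothInv u hu ^ 2))])
  have : FiniteDimensional ℂ S := FiniteDimensional.span_of_finite ℂ (finite_range _)
  let F : eigenspace (schrodingerOp V) E →ₗ[ℂ] S :=
    ((weightedPairing (smoothInv u hu)).comp (Submodule.subtype _)).codRestrict S fun f =>
      weightedPairing_mem_span hu hE ((mem_eigenspace_schrodingerOp V E _).1 f.2)
  refine FiniteDimensional.of_injective F ((injective_iff_map_eq_zero F).2 fun f hf => ?_)
  have h0 : weightedPairing (smoothInv u hu) (f : L2R) = 0 := congrArg Subtype.val hf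
  refine Subtype.ext (eq_zero_of_integral_test_eq_zero _ fun φ hφ => ?_)
  have h1 := LinearMap.congr_fun h0 ⟨u * φ, hφ.mul_left (f := u.1)⟩
  rw [weightedPairing_apply, ← mul_assoc, mul_comm (smoothInv u hu) u, mul_smoothInv, one_mul] at h1
  exact h1

/-! ### The Jordan chain at integer parameters -/

/-- The polynomial `q` in `w ^ 2` with `q + q' = (w ^ 2) ^ n`. -/
def chainPoly (hc : 0 < c) : ℕ → smoothFunctions
  | 0 => 1
  | n + 1 => wpow hc (2 * n + 2) - ((n : ℂ) + 1) • chainPoly hc n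

lemma D_chainPoly (hc : 0 < c) (n : ℕ) :
    D (chainPoly hc n) = (2 * Complex.I) • (wpow hc 1 * (wpow hc (2 * n) - chainPoly hc n)) := by
  induction n with
  | zero => simp [chainPoly, D_one, wpow_zero]
  | succ n ih =>
    rw [chainPoly, map_sub, map_smul, ih, D_wpow]
    have h1 : (2 * (n : ℝ) + 2 - 1) = 1 + 2 * n := by ring
    have h2 : (2 * ((n + 1 : ℕ) : ℝ)) = 2 * n + 2 := by push_cast; ring
    rw [h1, h2, wpow_add]
    simp only [mul_sub, smul_sub, mul_smul_comm, smul_smul]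
    push_cast
    module

/-- The polynomial has degree $n$ in $w^2$, and $|w|\ge c$ keeps the negative powers bounded. This
bounds `chainDeriv`. -/
lemma exists_norm_chainPoly_le (hc : 0 < c) (n : ℕ) :
    ∃ C, ∀ x, ‖(chainPoly hc n * wpow hc (-(2 * n))).1 x‖ ≤ C := by
  induction n with
  | zero => exact ⟨1, fun x => by simp [chainPoly, wpow_zero]⟩
  | succ n ih =>
    obtain ⟨C, hC⟩ := ih
    refine ⟨1 + (n + 1) * (C * c ^ (-2 : ℝ)), fun x => ?_⟩
    have h : chainPoly hc (n + 1) * wpow hc (-(2 * ((n + 1 : ℕ) : ℝ))) =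
        1 - ((n : ℂ) + 1) • (chainPoly hc n * wpow hc (-(2 * n)) * wpow hc (-2)) := by
      rw [chainPoly, sub_mul, ← wpow_add, smul_mul_assoc, mul_assoc, ← wpow_add]
      have h1 : 2 * (n : ℝ) + 2 + -(2 * ((n + 1 : ℕ) : ℝ)) = 0 := by push_cast; ring
      have h2 : -(2 * ((n + 1 : ℕ) : ℝ)) = -(2 * n) + -2 := by push_cast; ring
      rw [h1, wpow_zero, h2]
    rw [h]
    refine (norm_sub_le (1 : ℂ) _).trans ?_
    rw [norm_one]
    refine add_le_add le_rfl ?_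
    change ‖((n : ℂ) + 1) * ((chainPoly hc n * wpow hc (-(2 * n))).1 x * (wpow hc (-2)).1 x)‖ ≤ _
    rw [norm_mul, norm_mul]
    have h3 : ‖(n : ℂ) + 1‖ = n + 1 := by
      exact_mod_cast Complex.norm_natCast (n + 1)
    have h4 : ‖(wpow hc (-2)).1 x‖ ≤ c ^ (-2 : ℝ) := by
      rw [norm_wpow]
      exact Real.rpow_le_rpow_of_nonpos hc (le_norm_rot c x) (by norm_num)
    rw [h3]
    exact mul_le_mul_of_nonneg_left (mul_le_mul (hC x) h4 (norm_nonneg _)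
      ((norm_nonneg _).trans (hC x))) (by positivity)

lemma wfun_eigen (hc : 0 < c) (n : ℕ) :
    schrodingerExpr (oscPotential hc n) (wfun hc (1 / 2 + n)) =
      (2 * (n : ℂ) + 2) • wfun hc (1 / 2 + n) := by
  rw [schrodingerExpr_wfun]
  push_cast
  module

/-- The derivative of the quotient of the two members of the Jordan chain. -/
def chainDeriv (hc : 0 < c) (n : ℕ) : smoothFunctions :=
  (Complex.I / 2) • (chainPoly hc n * wpow hc (-(2 * n)) * wpow hc (-1))

/-- By reduction of order one needs $(u^2g')'=-u^2=-w^{2n+1}e^{w^2}$. Since $q+q'=y^n$ at $y=w^2$,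
the choice $u^2g'=\tfrac i2\,q(w^2)e^{w^2}$ works. For integer $n$ this primitive is elementary. -/
lemma wfun_chain (hc : 0 < c) (n : ℕ) :
    schrodingerExpr (oscPotential hc n) (wfun hc (1 / 2 + n) * primitive (chainDeriv hc n)) =
      (2 * (n : ℂ) + 2) • (wfun hc (1 / 2 + n) * primitive (chainDeriv hc n)) +
        wfun hc (1 / 2 + n) := by
  rw [schrodingerExpr_mul_of_eigen (wfun_eigen hc n), D_primitive]
  set u := wfun hc (1 / 2 + n) with hu
  have hne := wfun_ne_zero hc (1 / 2 + n)
  have huv := mul_smoothInv u hne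
  have h1 : u ^ 2 = wpow hc (2 * n) * wpow hc 1 * wgauss c ^ 2 := by
    rw [hu, wfun, mul_pow, pow_two, ← wpow_add, ← wpow_add]
    ring_nf
  have h2 : u ^ 2 * chainDeriv hc n = (Complex.I / 2) • (chainPoly hc n * wgauss c ^ 2) := by
    have h3 : wpow hc (2 * n) * wpow hc (-(2 * n)) = 1 := by
      rw [← wpow_add, add_neg_cancel, wpow_zero]
    have h4 : wpow hc 1 * wpow hc (-1) = 1 := by
      rw [← wpow_add, add_neg_cancel, wpow_zero]
    rw [h1, chainDeriv, mul_smul_comm]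
    congr 1
    linear_combination (wpow hc 1 * wpow hc (-1) * chainPoly hc n * wgauss c ^ 2) * h3 +
      (chainPoly hc n * wgauss c ^ 2) * h4
  have h5 : D (u ^ 2 * chainDeriv hc n) = -u ^ 2 := by
    rw [h2, map_smul, D_mul, D_chainPoly, pow_two, D_mul, D_wgauss hc, h1]
    have h6 : (Complex.I / 2) • ((2 * Complex.I) •
        (wpow hc 1 * (wpow hc (2 * n) - chainPoly hc n)) * (wgauss c * wgauss c) +
        chainPoly hc n * (Complex.I • (wpow hc 1 * wgauss c) * wgauss c +
          wgauss c * Complex.I • (wpow hc 1 * wgauss c))) =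
        (Complex.I * Complex.I) • (wpow hc (2 * n) * wpow hc 1 * wgauss c ^ 2) := by
      have h7 : wpow hc (2 * n) * wpow hc 1 * wgauss c ^ 2 =
          wpow hc 1 * (wpow hc (2 * n) - chainPoly hc n) * (wgauss c * wgauss c) +
          chainPoly hc n * (wpow hc 1 * (wgauss c * wgauss c)) := by ring
      have h8 : wgauss c * (wpow hc 1 * wgauss c) = wpow hc 1 * (wgauss c * wgauss c) := by ring
      rw [h7]
      simp only [smul_mul_assoc, mul_smul_comm, h8, mul_assoc, mul_add, smul_add, smul_smul]
      module
    rw [h6, Complex.I_mul_I, neg_one_smul]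
  rw [pow_two, D_mul, D_mul] at h5
  linear_combination (-smoothInv u hne) * h5 +
    (2 * D u * chainDeriv hc n + u * D (chainDeriv hc n) + u) * huv

lemma gaussianDecay_chain (hc : 0 < c) (n : ℕ) :
    GaussianDecay (wfun hc (1 / 2 + n) * primitive (chainDeriv hc n)).1 := by
  obtain ⟨C, hC⟩ := exists_norm_chainPoly_le hc n
  have hC0 : 0 ≤ C := (norm_nonneg _).trans (hC 0)
  have h1 : ∀ x, ‖(chainDeriv hc n).1 x‖ ≤ 1 / 2 * (C * c ^ (-1 : ℝ)) := by
    intro x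
    change ‖Complex.I / 2 * ((chainPoly hc n * wpow hc (-(2 * n))).1 x * (wpow hc (-1)).1 x)‖ ≤ _
    rw [norm_mul, norm_mul]
    have h2 : ‖Complex.I / 2‖ = 1 / 2 := by simp
    have h3 : ‖(wpow hc (-1)).1 x‖ ≤ c ^ (-1 : ℝ) := by
      rw [norm_wpow]
      exact Real.rpow_le_rpow_of_nonpos hc (le_norm_rot c x) (by norm_num)
    rw [h2]
    exact mul_le_mul_of_nonneg_left (mul_le_mul (hC x) h3 (norm_nonneg _) hC0) (by norm_num)
  have hK : 0 ≤ 1 / 2 * (C * c ^ (-1 : ℝ)) := by positivity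
  -- A bounded derivative gives linear growth, and the factor $2$ comes from
  -- $|x|\le2(1+x^2/8)\le2e^{x^2/8}$.
  refine gaussianDecay_wfun_mul hc _ (K := 1 / 2 * (C * c ^ (-1 : ℝ)) * 2) fun x => ?_
  have h4 : ‖(primitive (chainDeriv hc n)).1 x‖ ≤ 1 / 2 * (C * c ^ (-1 : ℝ)) * |x - 0| :=
    intervalIntegral.norm_integral_le_of_norm_le_const fun t _ => h1 t
  rw [sub_zero] at h4
  refine h4.trans ?_
  rw [mul_assoc _ (2 : ℝ)]
  refine mul_le_mul_of_nonneg_left ?_ hK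
  have := Real.add_one_le_exp (x ^ 2 / 8)
  nlinarith [sq_nonneg (|x| - 2), sq_abs x]

/-- The oscillator with integer parameter has a non-trivial Jordan block. -/
theorem exists_multiplicity_ne (hc : 0 < c) (n : ℕ) :
    ∃ E, IsEigenvalue (oscillator hc n) E ∧
      algebraicMultiplicity (oscillator hc n) E ≠ geometricMultiplicity (oscillator hc n) E := by
  set V := oscPotential hc n
  set u := wfun hc (1 / 2 + n)
  set f := u * primitive (chainDeriv hc n)
  have hu := memLp_wfun hc (1 / 2 + n)
  have hf : MemLp f.1 2 volume := (gaussianDecay_chain hc n).memLp (smooth_continuous _)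
  have hEu : MemLp ((2 * (n : ℂ) + 2) • u).1 2 volume := hu.const_smul _
  have hEf : MemLp ((2 * (n : ℂ) + 2) • f + u).1 2 volume := (hf.const_smul _).add hu
  have h1 := toLp_mem_schrodingerGraph V u _ hu hEu (wfun_eigen hc n)
  have h2 := toLp_mem_schrodingerGraph V f _ hf hEf (wfun_chain hc n)
  have h1' : hEu.toLp _ = (2 * (n : ℂ) + 2) • hu.toLp u.1 := rfl
  have h2' : hEf.toLp _ = (2 * (n : ℂ) + 2) • hf.toLp f.1 + hu.toLp u.1 := rfl
  rw [h1'] at h1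
  rw [h2'] at h2
  have h0 : hu.toLp u.1 ≠ 0 := by
    intro h
    have h3 := hu.coeFn_toLp
    rw [h] at h3
    have h4 : u.1 = fun _ => 0 := by
      refine Continuous.ae_eq_iff_eq volume (smooth_continuous u) continuous_const |>.1 ?_
      exact h3.symm.trans (Lp.coeFn_zero _ _ _)
    exact wfun_ne_zero hc _ 0 (congrFun h4 0)
  have hmem : hu.toLp u.1 ∈ eigenspace (oscillator hc n) (2 * (n : ℂ) + 2) :=
    (mem_eigenspace_schrodingerOp V _ _).2 h1
  refine ⟨2 * (n : ℂ) + 2, (Submodule.ne_bot_iff _).2 ⟨_, hmem, h0⟩,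
    algebraicMultiplicity_ne (finiteDimensional_eigenspace (wfun_ne_zero hc _) (wfun_eigen hc n))
      hmem h0 (f := hf.toLp f.1) ?_⟩
  rw [oscillator, schrodingerOp_graph]
  exact h2

/-! ### Fourier and Laplace integrals -/

open scoped FourierTransform in
/-- Injectivity of the Fourier transform on integrable functions. -/
lemma ae_eq_zero_of_forall_integral_exp_eq_zero {g : ℝ → ℂ} (hg : Integrable g)
    (h : ∀ s : ℝ, ∫ x, g x * Complex.exp (s * (x * Complex.I)) = 0) : g =ᵐ[volume] 0 := by
  have hF : ∀ v, 𝓕 g v = 0 := by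
    intro v
    rw [Real.fourier_real_eq_integral_exp_smul, ← h (-2 * Real.pi * v)]
    refine integral_congr_ae (Filter.Eventually.of_forall fun x => ?_)
    dsimp only
    rw [smul_eq_mul, mul_comm]
    congr 2
    push_cast
    ring
  refine ae_eq_zero_of_integral_contDiff_smul_eq_zero hg.locallyIntegrable fun φ hφ hc => ?_
  have h1 : HasCompactSupport (Complex.ofRealCLM ∘ φ) := hc.comp_left rfl
  have h2 : ContDiff ℝ ∞ (Complex.ofRealCLM ∘ φ) := by fun_prop
  -- Write the test function as the Fourier transform of a Schwartz function $\Psi$ and use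
  -- $\int\hat g\,\Psi=\int g\,\hat\Psi$.
  let Φ := h1.toSchwartzMap h2
  let Ψ : SchwartzMap ℝ ℂ := 𝓕⁻ Φ
  have h3 := VectorFourier.integral_fourierIntegral_smul_eq_flip (L := innerₗ ℝ)
    Real.continuous_fourierChar continuous_inner hg Ψ.integrable (μ := volume) (ν := volume)
  have h4 : ∀ x, VectorFourier.fourierIntegral Real.fourierChar volume (innerₗ ℝ).flip
      Ψ x = φ x := by
    intro x
    have h5 : 𝓕 (Ψ : ℝ → ℂ) x = φ x := by
      rw [← SchwartzMap.fourier_coe, FourierTransform.fourier_fourierInv_eq]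
      rfl
    rw [← h5, flip_innerₗ]
    rfl
  have h6 : ∀ v, VectorFourier.fourierIntegral Real.fourierChar volume (innerₗ ℝ) g v = 0 := hF
  simp only [h4, h6, zero_smul, integral_zero] at h3
  rw [h3]
  refine integral_congr_ae (Filter.Eventually.of_forall fun x => ?_)
  change (φ x : ℝ) • g x = g x * (φ x : ℂ)
  rw [Complex.real_smul, mul_comm]

lemma integrableOn_cpow_mul_exp {a : ℝ} (ha : 0 < a) {w : ℂ} (hw : 0 < w.re) :
    IntegrableOn (fun t : ℝ => (t : ℂ) ^ ((a : ℂ) - 1) * Complex.exp (-(w * t))) (Ioi 0) := by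
  have h := integrableOn_rpow_mul_exp_neg_mul_rpow (p := 1) (s := a - 1) (b := w.re) (by linarith)
    one_pos hw
  refine Integrable.mono' h ?_ ?_
  · refine ContinuousOn.aestronglyMeasurable (fun t ht => ?_) measurableSet_Ioi
    refine ContinuousAt.continuousWithinAt ?_
    have : ContinuousAt (fun t : ℝ => (t : ℂ) ^ ((a : ℂ) - 1)) t :=
      ContinuousAt.comp (f := fun t : ℝ => (t : ℂ)) (g := fun z : ℂ => z ^ ((a : ℂ) - 1))
        (continuousAt_cpow_const (Complex.ofReal_mem_slitPlane.2 ht))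
        Complex.continuous_ofReal.continuousAt
    exact this.mul (by fun_prop)
  · filter_upwards [ae_restrict_mem measurableSet_Ioi] with t ht
    rw [norm_mul, Complex.norm_cpow_eq_rpow_re_of_pos ht, Complex.norm_exp, Real.rpow_one]
    simp

/-- The Laplace transform of a power, at complex arguments. -/
lemma integral_cpow_mul_exp_neg_mul {a : ℝ} (ha : 0 < a) {w : ℂ} (hw : 0 < w.re) :
    ∫ t in Ioi (0 : ℝ), (t : ℂ) ^ ((a : ℂ) - 1) * Complex.exp (-(w * t)) =
      Complex.Gamma a * w ^ (-(a : ℂ)) := by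
  have hopen : IsOpen {w : ℂ | 0 < w.re} := isOpen_lt continuous_const Complex.continuous_re
  have hP : DifferentiableOn ℂ (fun w : ℂ => ∫ t in Ioi (0 : ℝ),
      (t : ℂ) ^ ((a : ℂ) - 1) * Complex.exp (-(w * t))) {w : ℂ | 0 < w.re} := by
    intro w hw
    have hw : 0 < w.re := hw
    refine DifferentiableAt.differentiableWithinAt ?_
    -- On this neighbourhood the $z$-derivative is dominated by $t^a e^{-(\mathrm{Re}\,w)t/2}$,
    -- uniformly in $z$.
    have hnhds : {z : ℂ | w.re / 2 < z.re} ∈ nhds w :=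
      (isOpen_lt continuous_const Complex.continuous_re).mem_nhds
        (show w.re / 2 < w.re by linarith)
    refine (hasDerivAt_integral_of_dominated_loc_of_deriv_le (μ := volume.restrict (Ioi 0)) hnhds
      (F := fun z t => (t : ℂ) ^ ((a : ℂ) - 1) * Complex.exp (-(z * t)))
      (F' := fun z t => (t : ℂ) ^ ((a : ℂ) - 1) * (Complex.exp (-(z * t)) * (-t)))
      (bound := fun t => t ^ a * Real.exp (-(w.re / 2) * t ^ (1 : ℝ))) ?_
      (integrableOn_cpow_mul_exp ha hw) ?_ ?_ ?_ ?_).2.differentiableAt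
    · filter_upwards [hopen.mem_nhds hw] with z hz
      exact (integrableOn_cpow_mul_exp ha hz).aestronglyMeasurable
    · have h1 := (integrableOn_cpow_mul_exp ha hw).aestronglyMeasurable.mul
        (Complex.continuous_ofReal.neg.aestronglyMeasurable (μ := volume.restrict (Ioi (0 : ℝ))))
      refine h1.congr (Filter.Eventually.of_forall fun t => ?_)
      exact mul_assoc _ _ _
    · filter_upwards [ae_restrict_mem measurableSet_Ioi] with t ht z hz
      have ht : 0 < t := ht
      have hz : w.re / 2 < z.re := hz
      rw [norm_mul, norm_mul, Complex.norm_cpow_eq_rpow_re_of_pos ht, Complex.norm_exp,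
        Real.rpow_one, norm_neg, Complex.norm_real, Real.norm_of_nonneg ht.le]
      have h1 : t ^ a = t ^ (a - 1) * t := by
        rw [Real.rpow_sub_one ht.ne']
        field_simp
      have h2 : ((a : ℂ) - 1).re = a - 1 := by simp
      have h3 : (-(z * t)).re = -(z.re * t) := by simp
      rw [h1, h2, h3]
      have h4 : Real.exp (-(z.re * t)) ≤ Real.exp (-(w.re / 2) * t) :=
        Real.exp_le_exp.2 (by nlinarith)
      calc t ^ (a - 1) * (Real.exp (-(z.re * t)) * t)
          ≤ t ^ (a - 1) * (Real.exp (-(w.re / 2) * t) * t) := by gcongr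
        _ = _ := by ring
    · exact integrableOn_rpow_mul_exp_neg_mul_rpow (by linarith) one_pos (by linarith)
    · refine Filter.Eventually.of_forall fun t z _ => ?_
      have h1 : HasDerivAt (fun z : ℂ => -(z * t)) (-t) z := by
        have h2 := ((hasDerivAt_id z).mul_const (t : ℂ)).neg
        rw [one_mul] at h2
        exact h2
      exact h1.cexp.const_mul _
  have hQ : DifferentiableOn ℂ (fun w : ℂ => Complex.Gamma a * w ^ (-(a : ℂ))) {w : ℂ | 0 < w.re} :=
    fun w hw => ((differentiableAt_id.cpow_const (Or.inl hw)).const_mul _).differentiableWithinAt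
  have hpre : IsPreconnected {w : ℂ | 0 < w.re} :=
    (convex_halfSpace_re_gt 0).isPreconnected
  refine (hP.analyticOnNhd hopen).eqOn_of_preconnected_of_frequently_eq
    (hQ.analyticOnNhd hopen) hpre (show (1 : ℂ) ∈ _ by simp) ?_ hw
  -- The formula is the Gamma integral for real $w>0$; positive reals accumulating at $1$ suffice
  -- for the identity theorem.
  have hlim : Filter.Tendsto (fun n : ℕ => ((1 + 1 / ((n : ℝ) + 1) : ℝ) : ℂ)) Filter.atTop
      (nhdsWithin 1 {1}ᶜ) := by
    refine tendsto_nhdsWithin_iff.2 ⟨?_, Filter.Eventually.of_forall fun n => ?_⟩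
    · have h1 := (tendsto_one_div_add_atTop_nhds_zero_nat (𝕜 := ℝ)).const_add 1
      have h2 := (Complex.continuous_ofReal.tendsto (1 + 0)).comp h1
      rw [add_zero, Complex.ofReal_one] at h2
      exact h2
    · have h1 : (0 : ℝ) < 1 / ((n : ℝ) + 1) := by positivity
      intro h2
      have h3 : ((1 + 1 / ((n : ℝ) + 1) : ℝ) : ℂ) = ((1 : ℝ) : ℂ) := by
        rw [Complex.ofReal_one]
        exact h2
      have h4 := Complex.ofReal_injective h3
      linarith
  refine hlim.frequently (Filter.Eventually.frequently (Filter.Eventually.of_forall fun n => ?_))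
  have hr : (0 : ℝ) < 1 + 1 / ((n : ℝ) + 1) := by positivity
  generalize 1 + 1 / ((n : ℝ) + 1) = r at hr
  have h1 := Complex.integral_cpow_mul_exp_neg_mul_Ioi (a := (a : ℂ)) (by simpa using ha) hr
  change ∫ t in Ioi (0 : ℝ), (t : ℂ) ^ ((a : ℂ) - 1) * Complex.exp (-((r : ℂ) * t)) = _
  rw [h1, one_div, Complex.inv_cpow _ _ (by rw [Complex.arg_ofReal_of_nonneg hr.le]; exact Real.pi_pos.ne),
    Complex.cpow_neg, mul_comm]

/-! ### Odd functions with odd fractional integrals -/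

/-- The two-sided Laplace transform. -/
def laplace (φ : ℝ → ℂ) (z : ℂ) : ℂ := ∫ s, φ s * Complex.exp (-(z * s))

lemma norm_mul_exp_le {c N : ℝ} {φ : ℝ → ℂ} (hb : ∀ s, ‖φ s‖ ≤ N * Real.exp (-c * |s|)) (z : ℂ)
    {δ : ℝ} (hz : |z.re| ≤ δ) (s : ℝ) :
    ‖φ s * Complex.exp (-(z * s))‖ ≤ N * Real.exp (-(c - δ) * |s|) := by
  have hN : 0 ≤ N * Real.exp (-c * |s|) := (norm_nonneg _).trans (hb s)
  rw [norm_mul, Complex.norm_exp]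
  have h1 : (-(z * s)).re = -(z.re * s) := by simp
  have h2 : -(z.re * s) ≤ δ * |s| := by
    calc -(z.re * s) ≤ |z.re * s| := neg_le_abs _
      _ = |z.re| * |s| := abs_mul _ _
      _ ≤ δ * |s| := mul_le_mul_of_nonneg_right hz (abs_nonneg _)
  calc ‖φ s‖ * Real.exp (-(z * s)).re ≤ N * Real.exp (-c * |s|) * Real.exp (δ * |s|) := by
        rw [h1]
        exact mul_le_mul (hb s) (Real.exp_le_exp.2 h2) (Real.exp_nonneg _) hN
    _ = _ := by
      rw [mul_assoc, ← Real.exp_add]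
      congr 2
      ring

lemma integrable_exp_neg_mul_abs {δ : ℝ} (hδ : 0 < δ) :
    Integrable fun s : ℝ => Real.exp (-δ * |s|) := by
  have h1 : IntegrableOn (fun s : ℝ => Real.exp (-δ * |s|)) (Ioi 0) := by
    refine (integrableOn_exp_mul_Ioi (neg_lt_zero.2 hδ) 0).congr_fun (fun s hs => ?_)
      measurableSet_Ioi
    rw [abs_of_pos hs]
  have h2 : IntegrableOn (fun s : ℝ => Real.exp (-δ * |s|)) (Iic 0) := by
    refine (integrableOn_exp_mul_Iic hδ 0).congr_fun (fun s hs => ?_) measurableSet_Iic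
    rw [abs_of_nonpos hs]
    ring_nf
  rw [← integrableOn_univ, ← Iic_union_Ioi (a := (0 : ℝ))]
  exact h2.union h1

lemma integrable_mul_exp {c N : ℝ} {φ : ℝ → ℂ} (hφ : Continuous φ)
    (hb : ∀ s, ‖φ s‖ ≤ N * Real.exp (-c * |s|)) {z : ℂ} (hz : |z.re| < c) :
    Integrable fun s : ℝ => φ s * Complex.exp (-(z * s)) := by
  refine Integrable.mono' ((integrable_exp_neg_mul_abs (sub_pos.2 hz)).const_mul N)
    (Continuous.aestronglyMeasurable (by fun_prop))
    (Filter.Eventually.of_forall fun s => norm_mul_exp_le hb z le_rfl s)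

lemma tendsto_laplace {c N : ℝ} (hc : 0 < c) {φ : ℝ → ℂ} (hφ : Continuous φ)
    (hb : ∀ s, ‖φ s‖ ≤ N * Real.exp (-c * |s|)) {z : ℕ → ℂ} {z₀ : ℂ}
    (hz : ∀ n, |(z n).re| ≤ c / 2) (hlim : Filter.Tendsto z Filter.atTop (nhds z₀)) :
    Filter.Tendsto (fun n => laplace φ (z n)) Filter.atTop (nhds (laplace φ z₀)) := by
  refine tendsto_integral_of_dominated_convergence (fun s => N * Real.exp (-(c - c / 2) * |s|))
    (fun n => Continuous.aestronglyMeasurable (by fun_prop))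
    ((integrable_exp_neg_mul_abs (by linarith)).const_mul N)
    (fun n => Filter.Eventually.of_forall fun s => norm_mul_exp_le hb (z n) (hz n) s)
    (Filter.Eventually.of_forall fun s => ?_)
  have : Continuous fun z : ℂ => φ s * Complex.exp (-(z * s)) := by fun_prop
  exact (this.tendsto z₀).comp hlim

lemma laplace_neg {φ : ℝ → ℂ} (hodd : ∀ s, φ (-s) = -φ s) (z : ℂ) :
    laplace φ (-z) = -laplace φ z := by
  rw [laplace, laplace, ← integral_neg, ← integral_neg_eq_self]
  refine integral_congr_ae (Filter.Eventually.of_forall fun s => ?_)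
  simp only [hodd, Complex.ofReal_neg, mul_neg, neg_mul, neg_neg]

/-- The hypothesis makes $\Gamma(a)\psi$ the convolution of $\varphi$ with $t_+^{a-1}$. Weighting by
$e^{-zs}$ respects convolution, and the integral of a convolution is a product. The kernel needs
$\mathrm{Re}\,z>0$, and $\varphi$ needs $\mathrm{Re}\,z<c$. -/
lemma laplace_fractionalIntegral {c N a : ℝ} (ha : 0 < a) {φ ψ : ℝ → ℂ}
    (hφ : Continuous φ) (hb : ∀ s, ‖φ s‖ ≤ N * Real.exp (-c * |s|))
    (hψ : ∀ s, ∫ t in Ioi (0 : ℝ), (t : ℂ) ^ ((a : ℂ) - 1) * φ (s - t) =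
      Complex.Gamma a * ψ s) {z : ℂ} (hz0 : 0 < z.re) (hzc : z.re < c) :
    laplace ψ z = z ^ (-(a : ℂ)) * laplace φ z := by
  have hf : Integrable ((Ioi (0 : ℝ)).indicator
      fun t : ℝ => (t : ℂ) ^ ((a : ℂ) - 1) * Complex.exp (-(z * t))) :=
    (integrable_indicator_iff measurableSet_Ioi).2 (integrableOn_cpow_mul_exp ha hz0)
  have hg : Integrable fun s : ℝ => φ s * Complex.exp (-(z * s)) :=
    integrable_mul_exp hφ hb (by rwa [abs_of_pos hz0])
  have h1 := integral_convolution (ContinuousLinearMap.mul ℝ ℂ) hf hg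
  rw [integral_indicator measurableSet_Ioi, integral_cpow_mul_exp_neg_mul ha hz0] at h1
  have h2 : ∀ s, convolution ((Ioi (0 : ℝ)).indicator
      fun t : ℝ => (t : ℂ) ^ ((a : ℂ) - 1) * Complex.exp (-(z * t)))
      (fun s : ℝ => φ s * Complex.exp (-(z * s))) (ContinuousLinearMap.mul ℝ ℂ) volume s =
      Complex.Gamma a * (ψ s * Complex.exp (-(z * s))) := by
    intro s
    rw [convolution_def, ← mul_assoc, ← hψ, ← integral_mul_const,
      ← integral_indicator measurableSet_Ioi]
    refine integral_congr_ae (Filter.Eventually.of_forall fun t => ?_)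
    by_cases ht : t ∈ Ioi (0 : ℝ)
    · simp only [indicator_of_mem ht, ContinuousLinearMap.mul_apply']
      have : Complex.exp (-(z * s)) = Complex.exp (-(z * t)) * Complex.exp (-(z * (s - t : ℝ))) := by
        rw [← Complex.exp_add]
        congr 1
        push_cast
        ring
      rw [this]
      ring
    · simp only [indicator_of_notMem ht, map_zero, zero_apply]
  rw [integral_congr_ae (Filter.Eventually.of_forall h2), integral_const_mul] at h1
  have h3 : Complex.Gamma a ≠ 0 := by
    rw [Complex.Gamma_ofReal]
    exact_mod_cast (Real.Gamma_pos_of_pos ha).ne'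
  refine mul_left_cancel₀ h3 ?_
  rw [laplace, h1, ContinuousLinearMap.mul_apply', laplace, mul_assoc]

/-- The arguments are $\pm\pi/2$, so the two sides differ by the phase $e^{-i\pi a}$, which is $1$
only for even integers $a$. -/
lemma cpow_mul_I_ne {a ξ : ℝ} (ha : ∀ n : ℤ, a ≠ 2 * n) (hξ : 0 < ξ) :
    ((ξ : ℂ) * Complex.I) ^ (-(a : ℂ)) ≠ (-((ξ : ℂ) * Complex.I)) ^ (-(a : ℂ)) := by
  have hξ' : (ξ : ℂ) ≠ 0 := by exact_mod_cast hξ.ne'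
  have h1 : Complex.log ((ξ : ℂ) * Complex.I) = Real.log ξ + Real.pi / 2 * Complex.I := by
    rw [Complex.log_ofReal_mul hξ Complex.I_ne_zero, Complex.log_I]
  have h2 : Complex.log (-((ξ : ℂ) * Complex.I)) = Real.log ξ - Real.pi / 2 * Complex.I := by
    rw [← mul_neg, Complex.log_ofReal_mul hξ (neg_ne_zero.2 Complex.I_ne_zero), Complex.log_neg_I]
    ring
  intro h
  rw [Complex.cpow_def_of_ne_zero (mul_ne_zero hξ' Complex.I_ne_zero),
    Complex.cpow_def_of_ne_zero (neg_ne_zero.2 (mul_ne_zero hξ' Complex.I_ne_zero)), h1, h2,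
    Complex.exp_eq_exp_iff_exists_int] at h
  obtain ⟨n, hn⟩ := h
  have hpi : (Real.pi : ℂ) * Complex.I ≠ 0 :=
    mul_ne_zero (by exact_mod_cast Real.pi_ne_zero) Complex.I_ne_zero
  have h3 : (a : ℂ) = -2 * n := by
    refine mul_left_cancel₀ hpi ?_
    linear_combination -hn
  refine ha (-n) ?_
  push_cast
  have : a = -2 * n := by exact_mod_cast h3
  linarith

/-- An odd exponentially decaying function whose fractional integral of order `a ∉ 2ℤ` is again odd
and exponentially decaying vanishes. -/
lemma eq_zero_of_odd_fractionalIntegral {c N M a : ℝ} (hc : 0 < c) (ha : 0 < a)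
    (ha2 : ∀ n : ℤ, a ≠ 2 * n) {φ ψ : ℝ → ℂ} (hφ : Continuous φ) (hψ : Continuous ψ)
    (hφb : ∀ s, ‖φ s‖ ≤ N * Real.exp (-c * |s|)) (hψb : ∀ s, ‖ψ s‖ ≤ M * Real.exp (-c * |s|))
    (hφo : ∀ s, φ (-s) = -φ s) (hψo : ∀ s, ψ (-s) = -ψ s)
    (h : ∀ s, ∫ t in Ioi (0 : ℝ), (t : ℂ) ^ ((a : ℂ) - 1) * φ (s - t) = Complex.Gamma a * ψ s) :
    φ = 0 := by
  have hbd : ∀ ξ : ℝ, ξ ≠ 0 → laplace ψ (ξ * Complex.I) =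
      (ξ * Complex.I) ^ (-(a : ℂ)) * laplace φ (ξ * Complex.I) := by
    intro ξ hξ
    -- The product formula holds only in the open strip; approach the imaginary axis from the right.
    -- The point $\xi=0$ is excluded because the power need not be continuous there.
    let z : ℕ → ℂ := fun n => ((c / 2 * (1 / ((n : ℝ) + 1)) : ℝ) : ℂ) + ξ * Complex.I
    have hzre : ∀ n, (z n).re = c / 2 * (1 / ((n : ℝ) + 1)) := fun n => by
      simp only [z, Complex.add_re, Complex.ofReal_re, Complex.re_ofReal_mul, Complex.I_re, mul_zero,
        add_zero]
    have hzpos : ∀ n, 0 < (z n).re := fun n => by rw [hzre]; positivity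
    have hzle : ∀ n, (z n).re ≤ c / 2 := fun n => by
      rw [hzre]
      refine mul_le_of_le_one_right (by positivity) ?_
      rw [div_le_one (by positivity)]
      linarith [n.cast_nonneg (α := ℝ)]
    have hzabs : ∀ n, |(z n).re| ≤ c / 2 := fun n => by rw [abs_of_pos (hzpos n)]; exact hzle n
    have hlim : Filter.Tendsto z Filter.atTop (nhds (ξ * Complex.I)) := by
      have h1 := (tendsto_one_div_add_atTop_nhds_zero_nat (𝕜 := ℝ)).const_mul (c / 2)
      have h2 := ((Complex.continuous_ofReal.tendsto (c / 2 * 0)).comp h1).add_const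
        ((ξ : ℂ) * Complex.I)
      rw [mul_zero, Complex.ofReal_zero, zero_add] at h2
      exact h2
    have hslit : (ξ : ℂ) * Complex.I ∈ Complex.slitPlane := Or.inr (by simpa using hξ)
    have h1 := tendsto_laplace hc hψ hψb hzabs hlim
    have h2 := (((continuousAt_cpow_const hslit).tendsto.comp hlim).mul
      (tendsto_laplace hc hφ hφb hzabs hlim) :
        Filter.Tendsto (fun n => z n ^ (-(a : ℂ)) * laplace φ (z n)) _ _)
    refine tendsto_nhds_unique h1 (h2.congr fun n => ?_)
    exact (laplace_fractionalIntegral ha hφ hφb h (hzpos n) (by linarith [hzle n])).symm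
  have hpos : ∀ ξ : ℝ, 0 < ξ → laplace φ (ξ * Complex.I) = 0 := by
    intro ξ hξ
    have h1 := hbd ξ hξ.ne'
    have h2 := hbd (-ξ) (neg_ne_zero.2 hξ.ne')
    rw [Complex.ofReal_neg, neg_mul, laplace_neg hφo, laplace_neg hψo, h1] at h2
    -- Compare the formulas at $\pm i\xi$: oddness of both transforms leaves the difference of the
    -- two powers times one value.
    have h3 : (((ξ : ℂ) * Complex.I) ^ (-(a : ℂ)) - (-((ξ : ℂ) * Complex.I)) ^ (-(a : ℂ))) *
        laplace φ (ξ * Complex.I) = 0 := by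
      linear_combination -h2
    exact (mul_eq_zero.1 h3).resolve_left (sub_ne_zero.2 (cpow_mul_I_ne ha2 hξ))
  have hall : ∀ ξ : ℝ, laplace φ (ξ * Complex.I) = 0 := by
    intro ξ
    rcases lt_trichotomy ξ 0 with hξ | hξ | hξ
    · have h1 := hpos (-ξ) (by linarith)
      rwa [Complex.ofReal_neg, neg_mul, laplace_neg hφo, neg_eq_zero] at h1
    · subst hξ
      have h1 := laplace_neg hφo 0
      rw [neg_zero] at h1
      rw [Complex.ofReal_zero, zero_mul]
      exact self_eq_neg.1 h1
    · exact hpos ξ hξ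
  have hint : Integrable φ := by
    have := integrable_mul_exp hφ hφb (z := 0) (by simpa using hc)
    simpa using this
  have hae : φ =ᵐ[volume] 0 := by
    refine ae_eq_zero_of_forall_integral_exp_eq_zero hint fun s => ?_
    rw [← hall (-s), laplace]
    refine integral_congr_ae (Filter.Eventually.of_forall fun x => ?_)
    dsimp only
    congr 2
    push_cast
    ring
  exact (Continuous.ae_eq_iff_eq volume hφ continuous_const).1 hae

/-! ### Completeness -/

lemma exp_mul_abs_le (K x : ℝ) :
    Real.exp (K * |x|) ≤ Real.exp (2 * K ^ 2) * Real.exp (x ^ 2 / 8) := by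
  rw [← Real.exp_add]
  refine Real.exp_le_exp.2 ?_
  nlinarith [sq_nonneg (|x| - 4 * K), sq_abs x]

lemma memLp_wfun_mul (hc : 0 < c) (m : ℝ) {e : ℝ → ℂ} (he : Continuous e) {C K : ℝ}
    (hC : 0 ≤ C) (hb : ∀ x, ‖e x‖ ≤ C * Real.exp (K * |x|)) :
    MemLp (fun x => (wfun hc m).1 x * e x) 2 volume := by
  refine (gaussianDecay_wfun_mul hc m (K := C * Real.exp (2 * K ^ 2)) fun x => ?_).memLp
    ((smooth_continuous _).mul he)
  rw [mul_assoc]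
  exact (hb x).trans (mul_le_mul_of_nonneg_left (exp_mul_abs_le K x) hC)

lemma integrable_mul_wfun_mul (hc : 0 < c) (h : L2R) (m : ℝ) {e : ℝ → ℂ} (he : Continuous e)
    {C K : ℝ} (hC : 0 ≤ C) (hb : ∀ x, ‖e x‖ ≤ C * Real.exp (K * |x|)) :
    Integrable fun x => h x * ((wfun hc m).1 x * e x) :=
  (Lp.memLp h).integrable_mul (memLp_wfun_mul hc m he hC hb)

lemma integrable_mul_wfun (hc : 0 < c) (h : L2R) (m : ℝ) :
    Integrable fun x => h x * (wfun hc m).1 x :=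
  (Lp.memLp h).integrable_mul (memLp_wfun hc m)

lemma continuous_rot (c : ℝ) : Continuous (rot c) := (contDiff_rot c).continuous

lemma norm_exp_mul_rot (s x : ℝ) : ‖Complex.exp (s * rot c x)‖ = Real.exp (c * s) := by
  rw [Complex.norm_exp, Complex.re_ofReal_mul, rot_re, mul_comm]

/-- The generating function `s ↦ ∫ h w ^ m exp (w ^ 2 / 2) exp (s w)` of the moments of `h`. -/
def generating (hc : 0 < c) (h : L2R) (m s : ℝ) : ℂ :=
  ∫ x, h x * (wfun hc m).1 x * Complex.exp (s * rot c x)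

lemma integrable_generating (hc : 0 < c) (h : L2R) (m s : ℝ) :
    Integrable fun x => h x * (wfun hc m).1 x * Complex.exp (s * rot c x) := by
  have := integrable_mul_wfun_mul hc h m (e := fun x => Complex.exp (s * rot c x))
    ((continuous_const.mul (continuous_rot c)).cexp) (C := Real.exp (c * s)) (K := 0)
    (Real.exp_nonneg _) fun x => by rw [norm_exp_mul_rot, zero_mul, Real.exp_zero, mul_one]
  simpa only [mul_assoc] using this

lemma norm_generating_le (hc : 0 < c) (h : L2R) (m s : ℝ) :
    ‖generating hc h m s‖ ≤ (∫ x, ‖h x * (wfun hc m).1 x‖) * Real.exp (c * s) := by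
  refine (norm_integral_le_integral_norm _).trans (le_of_eq ?_)
  rw [← integral_mul_const]
  refine integral_congr_ae (Filter.Eventually.of_forall fun x => ?_)
  dsimp only
  rw [norm_mul _ (Complex.exp _), norm_exp_mul_rot]

lemma generating_eq (hc : 0 < c) (h : L2R) (m s : ℝ) :
    generating hc h m s = Complex.exp (s * c) *
      ∫ x, h x * (wfun hc m).1 x * Complex.exp (s * (x * Complex.I)) := by
  rw [generating, ← integral_const_mul]
  refine integral_congr_ae (Filter.Eventually.of_forall fun x => ?_)
  dsimp only
  rw [rot, mul_add, Complex.exp_add]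
  ring

lemma norm_exp_mul_mul_I (s x : ℝ) : ‖Complex.exp (s * (x * Complex.I))‖ = 1 := by
  rw [← mul_assoc, ← Complex.ofReal_mul, Complex.norm_exp_ofReal_mul_I]

lemma continuous_generating (hc : 0 < c) (h : L2R) (m : ℝ) : Continuous (generating hc h m) := by
  rw [funext (generating_eq hc h m)]
  refine Continuous.mul (by fun_prop) ?_
  refine continuous_of_dominated (bound := fun x => ‖h x * (wfun hc m).1 x‖) (fun s => ?_)
    (fun s => Filter.Eventually.of_forall fun x => ?_) (integrable_mul_wfun hc h m).norm
    (Filter.Eventually.of_forall fun x => by fun_prop)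
  · exact (integrable_mul_wfun hc h m).aestronglyMeasurable.mul
      (Continuous.aestronglyMeasurable (by fun_prop))
  · rw [norm_mul _ (Complex.exp _), norm_exp_mul_mul_I, mul_one]

lemma wfun_add_two_mul (hc : 0 < c) (m : ℝ) (k : ℕ) (x : ℝ) :
    (wfun hc (m + 2 * k)).1 x = (wfun hc m).1 x * rot c x ^ (2 * k) := by
  have h1 : ((m + 2 * k : ℝ) : ℂ) = (m : ℂ) + ((2 * k : ℕ) : ℂ) := by push_cast; ring
  rw [wfun_apply, wfun_apply, h1, Complex.cpow_add _ _ (rot_ne_zero hc x), Complex.cpow_natCast]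
  ring

/-- Expand $\cosh(sw)$ in even powers: each $w^{2k}$ shifts $m$ by $2k$, giving a vanishing moment.
The majorant $\cosh(|s||w|)\le e^{|s|(c+|x|)}$ is beaten by the Gaussian. -/
lemma integral_mul_cosh_eq_zero (hc : 0 < c) (h : L2R) (m : ℝ)
    (h0 : ∀ k : ℕ, ∫ x, h x * (wfun hc (m + 2 * k)).1 x = 0) (s : ℝ) :
    ∫ x, h x * (wfun hc m).1 x * Complex.cosh (s * rot c x) = 0 := by
  have hsum := hasSum_integral_of_dominated_convergence (μ := volume)
    (F := fun (k : ℕ) x => h x * (wfun hc m).1 x * ((s * rot c x) ^ (2 * k) / ((2 * k).factorial : ℂ)))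
    (f := fun x => h x * (wfun hc m).1 x * Complex.cosh (s * rot c x))
    (fun k x => ‖h x * (wfun hc m).1 x‖ * ((|s| * ‖rot c x‖) ^ (2 * k) / ((2 * k).factorial : ℝ)))
    (fun k => ?_) (fun k => Filter.Eventually.of_forall fun x => ?_)
    (Filter.Eventually.of_forall fun x => (Real.hasSum_cosh _).summable.mul_left _) ?_
    (Filter.Eventually.of_forall fun x => (Complex.hasSum_cosh _).mul_left _)
  · refine hsum.unique ?_
    convert hasSum_zero with k
    have h1 : ∀ x, h x * (wfun hc m).1 x * ((s * rot c x) ^ (2 * k) / ((2 * k).factorial : ℂ)) =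
        ((s : ℂ) ^ (2 * k) / ((2 * k).factorial : ℂ)) * (h x * (wfun hc (m + 2 * k)).1 x) := by
      intro x
      rw [wfun_add_two_mul, mul_pow]
      ring
    simp only [h1]
    rw [integral_const_mul, h0, mul_zero]
  · refine (integrable_mul_wfun hc h m).aestronglyMeasurable.mul
      (Continuous.aestronglyMeasurable ?_)
    exact ((continuous_const.mul (continuous_rot c)).pow _).div_const _
  · refine le_of_eq ?_
    rw [norm_mul _ (_ / _), norm_div, norm_pow, norm_mul (s : ℂ), Complex.norm_real,
      Complex.norm_natCast, Real.norm_eq_abs]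
  · have h2 : ∀ x, ∑' k : ℕ, ‖h x * (wfun hc m).1 x‖ *
        ((|s| * ‖rot c x‖) ^ (2 * k) / ((2 * k).factorial : ℝ)) =
        ‖h x * ((wfun hc m).1 x * (Real.cosh (|s| * ‖rot c x‖) : ℂ))‖ := by
      intro x
      rw [tsum_mul_left, ← Real.cosh_eq_tsum, ← mul_assoc,
        norm_mul _ ((Real.cosh (|s| * ‖rot c x‖) : ℝ) : ℂ), Complex.norm_real,
        Real.norm_of_nonneg (Real.cosh_pos _).le]
    simp only [h2]
    refine (integrable_mul_wfun_mul hc h m (C := Real.exp (|s| * c)) (K := |s|) ?_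
      (Real.exp_nonneg _) fun x => ?_).norm
    · exact Complex.continuous_ofReal.comp
        (Real.continuous_cosh.comp (continuous_const.mul (continuous_rot c).norm))
    · rw [Complex.norm_real, Real.norm_of_nonneg (Real.cosh_pos _).le, ← Real.exp_add, ← mul_add]
      have h3 : 0 ≤ |s| * ‖rot c x‖ := by positivity
      have h4 : Real.cosh (|s| * ‖rot c x‖) ≤ Real.exp (|s| * ‖rot c x‖) := by
        rw [Real.cosh_eq]
        have := Real.exp_le_exp.2 (by linarith : -(|s| * ‖rot c x‖) ≤ |s| * ‖rot c x‖)
        linarith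
      exact h4.trans (Real.exp_le_exp.2
        (mul_le_mul_of_nonneg_left (norm_rot_le hc x) (abs_nonneg s)))

lemma generating_neg (hc : 0 < c) (h : L2R) (m : ℝ)
    (h0 : ∀ k : ℕ, ∫ x, h x * (wfun hc (m + 2 * k)).1 x = 0) (s : ℝ) :
    generating hc h m (-s) = -generating hc h m s := by
  rw [← sub_eq_zero, sub_neg_eq_add, generating, generating,
    ← integral_add (integrable_generating hc h m (-s)) (integrable_generating hc h m s)]
  rw [← mul_zero (2 : ℂ), ← integral_mul_cosh_eq_zero hc h m h0 s, ← integral_const_mul]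
  refine integral_congr_ae (Filter.Eventually.of_forall fun x => ?_)
  dsimp only
  rw [Complex.cosh, Complex.ofReal_neg, neg_mul]
  ring

/-- Since $|e^{sw}|=e^{cs}$, the trivial bound decays for $s\to-\infty$; oddness carries this decay
over to $s>0$. -/
lemma norm_generating_le_abs (hc : 0 < c) (h : L2R) (m : ℝ)
    (h0 : ∀ k : ℕ, ∫ x, h x * (wfun hc (m + 2 * k)).1 x = 0) (s : ℝ) :
    ‖generating hc h m s‖ ≤ (∫ x, ‖h x * (wfun hc m).1 x‖) * Real.exp (-c * |s|) := by
  rcases le_or_gt s 0 with hs | hs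
  · have := norm_generating_le hc h m s
    rwa [abs_of_nonpos hs, neg_mul_neg]
  · have := norm_generating_le hc h m (-s)
    rw [generating_neg hc h m h0, norm_neg, mul_neg, ← neg_mul] at this
    rwa [abs_of_pos hs]

/-- Fubini and $\int_0^\infty t^{a-1}e^{(s-t)w}dt=\Gamma(a)w^{-a}e^{sw}$. -/
lemma integral_generating (hc : 0 < c) (h : L2R) (m : ℝ) {a : ℝ} (ha : 0 < a) (s : ℝ) :
    ∫ t in Ioi (0 : ℝ), (t : ℂ) ^ ((a : ℂ) - 1) * generating hc h m (s - t) =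
      Complex.Gamma a * generating hc h (m - a) s := by
  -- Splitting off the unimodular factor $e^{-itx}$ leaves a product of a function of $t$ and a
  -- function of $x$.
  have hint : Integrable (Function.uncurry fun (t x : ℝ) =>
      ((t : ℂ) ^ ((a : ℂ) - 1) * Complex.exp (-(c * t))) *
        (h x * (wfun hc m).1 x * Complex.exp (s * rot c x)) * Complex.exp (-(t * (x * Complex.I))))
      ((volume.restrict (Ioi (0 : ℝ))).prod volume) := by
    have h1 := (integrableOn_cpow_mul_exp ha (w := c) (by simpa using hc)).mul_prod
      (integrable_generating hc h m s)
    refine h1.mono (h1.aestronglyMeasurable.mul (Continuous.aestronglyMeasurable (by fun_prop)))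
      (Filter.Eventually.of_forall fun p => le_of_eq ?_)
    have h2 : ‖Complex.exp (-((p.1 : ℂ) * (p.2 * Complex.I)))‖ = 1 := by
      rw [← neg_mul, ← Complex.ofReal_neg, norm_exp_mul_mul_I]
    change ‖_ * _ * _‖ = _
    rw [norm_mul _ (Complex.exp (-((p.1 : ℂ) * (p.2 * Complex.I)))), h2, mul_one]
  have hL : ∀ t : ℝ, (t : ℂ) ^ ((a : ℂ) - 1) * generating hc h m (s - t) =
      ∫ x, ((t : ℂ) ^ ((a : ℂ) - 1) * Complex.exp (-(c * t))) *
        (h x * (wfun hc m).1 x * Complex.exp (s * rot c x)) *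
        Complex.exp (-(t * (x * Complex.I))) := by
    intro t
    rw [generating, ← integral_const_mul]
    refine integral_congr_ae (Filter.Eventually.of_forall fun x => ?_)
    have h3 : Complex.exp (((s - t : ℝ) : ℂ) * rot c x) = Complex.exp (s * rot c x) *
        (Complex.exp (-(c * t)) * Complex.exp (-(t * (x * Complex.I)))) := by
      rw [← Complex.exp_add, ← Complex.exp_add, rot]
      congr 1
      push_cast
      ring
    dsimp only
    rw [h3]
    ring
  simp only [hL]
  rw [integral_integral_swap hint, generating, ← integral_const_mul]
  refine integral_congr_ae (Filter.Eventually.of_forall fun x => ?_)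
  have h4 : ∀ t : ℝ, ((t : ℂ) ^ ((a : ℂ) - 1) * Complex.exp (-(c * t))) *
        (h x * (wfun hc m).1 x * Complex.exp (s * rot c x)) *
        Complex.exp (-(t * (x * Complex.I))) =
      (h x * (wfun hc m).1 x * Complex.exp (s * rot c x)) *
        ((t : ℂ) ^ ((a : ℂ) - 1) * Complex.exp (-(rot c x * t))) := by
    intro t
    have h5 : Complex.exp (-(rot c x * t)) =
        Complex.exp (-(c * t)) * Complex.exp (-(t * (x * Complex.I))) := by
      rw [← Complex.exp_add, rot]
      congr 1
      ring
    rw [h5]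
    ring
  simp only [h4]
  rw [integral_const_mul, integral_cpow_mul_exp_neg_mul ha (by rwa [rot_re])]
  have h6 : (wfun hc (m - a)).1 x = (wfun hc m).1 x * rot c x ^ (-(a : ℂ)) := by
    rw [wfun_apply, wfun_apply, Complex.ofReal_sub, sub_eq_add_neg,
      Complex.cpow_add _ _ (rot_ne_zero hc x)]
    ring
  rw [h6]
  ring

/-- For non-integer `α`, the functions `w ^ (1/2 ± α + 2 k) exp (w ^ 2 / 2)` are complete. -/
theorem eq_zero_of_moments_eq_zero (hc : 0 < c) {α : ℝ} (hα : 0 < α) (hα' : ∀ n : ℤ, α ≠ n)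
    (h : L2R) (h1 : ∀ k : ℕ, ∫ x, h x * (wfun hc (1 / 2 + α + 2 * k)).1 x = 0)
    (h2 : ∀ k : ℕ, ∫ x, h x * (wfun hc (1 / 2 - α + 2 * k)).1 x = 0) : h = 0 := by
  have hm : 1 / 2 + α - 2 * α = 1 / 2 - α := by ring
  have hzero : generating hc h (1 / 2 + α) = 0 := by
    -- The order $2\alpha$ leads from one ladder to the other, and it is an even integer only if
    -- $\alpha$ is an integer.
    refine eq_zero_of_odd_fractionalIntegral hc (a := 2 * α) (by linarith)
      (fun n hn => hα' n (by linarith)) (continuous_generating hc h _)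
      (continuous_generating hc h (1 / 2 - α)) (norm_generating_le_abs hc h _ h1)
      (norm_generating_le_abs hc h _ h2) (generating_neg hc h _ h1) (generating_neg hc h _ h2)
      fun s => ?_
    rw [← hm]
    exact integral_generating hc h (1 / 2 + α) (by linarith) s
  have hae := ae_eq_zero_of_forall_integral_exp_eq_zero (integrable_mul_wfun hc h (1 / 2 + α))
    fun s => by
      have h3 := generating_eq hc h (1 / 2 + α) s
      rw [hzero] at h3
      exact (mul_eq_zero.1 h3.symm).resolve_left (Complex.exp_ne_zero _)
  rw [Lp.eq_zero_iff_ae_eq_zero]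
  filter_upwards [hae] with x hx
  exact (mul_eq_zero.1 hx).resolve_right (wfun_ne_zero hc _ x)

/-! ### Diagonalization -/

lemma dense_span_range_of_forall {X : Type*} [NormedAddCommGroup X] [InnerProductSpace ℂ X]
    [CompleteSpace X] {φ : ℕ → X} (h : ∀ f, (∀ n, ⟪φ n, f⟫_ℂ = 0) → f = 0) :
    Dense (Submodule.span ℂ (range φ) : Set X) := by
  rw [Submodule.dense_iff_topologicalClosure_eq_top, Submodule.topologicalClosure_eq_top_iff,
    Submodule.eq_bot_iff]
  intro f hf
  exact h f fun n => hf _ (Submodule.subset_span ⟨n, rfl⟩)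

/-- Conjugating the first slot turns the inner product into the bilinear pairing for which the
operator is symmetric. -/
lemma inner_star_toLp {u : ℝ → ℂ} (hu : MemLp u 2 volume) (f : L2R) :
    ⟪star (hu.toLp u), f⟫_ℂ = ∫ x, f x * u x := by
  rw [L2.inner_def]
  refine integral_congr_ae ?_
  filter_upwards [Lp.coeFn_star (hu.toLp u), hu.coeFn_toLp] with x h1 h2
  rw [h1, Pi.star_apply, h2, RCLike.inner_apply, RCLike.star_def, RCLike.conj_conj]

lemma inner_toLp {u : ℝ → ℂ} (hu : MemLp u 2 volume) (f : L2R) :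
    ⟪hu.toLp u, f⟫_ℂ = starRingEnd ℂ (∫ x, star f x * u x) := by
  rw [L2.inner_def, ← integral_conj]
  refine integral_congr_ae ?_
  filter_upwards [Lp.coeFn_star f, hu.coeFn_toLp] with x h1 h2
  rw [h1, Pi.star_apply, h2, RCLike.inner_apply, RCLike.star_def, map_mul, RCLike.conj_conj]

/-- A complete system of square-integrable smooth eigenfunctions with different eigenvalues
diagonalizes the operator, the left eigenvectors being the complex conjugates of the right
eigenvectors. -/
theorem isDiagonalizable_of_complete {V : smoothFunctions} {u : ℕ → smoothFunctions} {E : ℕ → ℂ}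
    (hE : Function.Injective E) (hu : ∀ n, schrodingerExpr V (u n) = E n • u n)
    (hu0 : ∀ n, u n ≠ 0) (hL : ∀ n, MemLp (u n).1 2 volume) (hD : ∀ n, MemLp (D (u n)).1 2 volume)
    (hcomplete : ∀ h : L2R, (∀ n, ∫ x, h x * (u n).1 x = 0) → h = 0) :
    IsDiagonalizable (schrodingerOp V) ∧
      ∀ e, IsEigenvalue (schrodingerOp V) e → ∃ n, e = E n := by
  let φ : ℕ → L2R := fun n => (hL n).toLp (u n).1
  have hL' : ∀ n, MemLp (E n • u n).1 2 volume := fun n => (hL n).const_smul _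
  have hφG : ∀ n, (φ n, E n • φ n) ∈ schrodingerGraph V := fun n =>
    toLp_mem_schrodingerGraph V (u n) _ (hL n) (hL' n) (hu n)
  have hsymm : ∀ n, ∀ p ∈ schrodingerGraph V,
      ⟪star (φ n), p.2⟫_ℂ = E n * ⟪star (φ n), p.1⟫_ℂ := by
    intro n p hp
    rw [inner_star_toLp, inner_star_toLp,
      ← integral_mul_schrodingerExpr_of_mem_graph hp (u n) (hL n) (hD n) (by rw [hu]; exact hL' n),
      hu, ← integral_const_mul]
    refine integral_congr_ae (Filter.Eventually.of_forall fun x => ?_)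
    change p.1 x * (E n * (u n).1 x) = _
    ring
  have horth : ∀ m n, m ≠ n → ⟪star (φ m), φ n⟫_ℂ = 0 := by
    intro m n hmn
    have h1 := hsymm m _ (hφG n)
    rw [inner_smul_right] at h1
    exact (mul_eq_mul_right_iff.1 h1).resolve_left fun h => hmn (hE h).symm
  have hφ0 : ∀ n, φ n ≠ 0 := by
    intro n h0
    have h1 := (hL n).coeFn_toLp
    have h2 : (hL n).toLp (u n).1 = 0 := h0
    rw [h2] at h1
    refine hu0 n (Subtype.ext ?_)
    exact (Continuous.ae_eq_iff_eq volume (smooth_continuous (u n)) continuous_const).1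
      (h1.symm.trans (Lp.coeFn_zero _ _ _))
  have hcomplete' : ∀ f : L2R, (∀ n, ⟪star (φ n), f⟫_ℂ = 0) → f = 0 := fun f hf =>
    hcomplete f fun n => by rw [← inner_star_toLp (hL n)]; exact hf n
  -- The bilinear square $\int u_n^2$ is not automatically nonzero; if it vanished, $\varphi_n$
  -- would annihilate the whole system and be zero by completeness.
  have hN : ∀ n, ⟪star (φ n), φ n⟫_ℂ ≠ 0 := by
    intro n h0
    refine hφ0 n (hcomplete' _ fun m => ?_)
    by_cases hmn : m = n
    · rw [hmn, h0]
    · exact horth m n hmn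
  let χ : ℕ → L2R := fun n => (starRingEnd ℂ ⟪star (φ n), φ n⟫_ℂ)⁻¹ • star (φ n)
  have hχ : ∀ n f, ⟪χ n, f⟫_ℂ = (⟪star (φ n), φ n⟫_ℂ)⁻¹ * ⟪star (φ n), f⟫_ℂ := by
    intro n f
    rw [inner_smul_left, map_inv₀, Complex.conj_conj]
  have hχd : Dense (Submodule.span ℂ (range χ) : Set L2R) := by
    refine dense_span_range_of_forall fun f hf => hcomplete' f fun n => ?_
    have h1 := hf n
    rw [hχ] at h1
    exact (mul_eq_zero.1 h1).resolve_left (inv_ne_zero (hN n))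
  have hφd : Dense (Submodule.span ℂ (range φ) : Set L2R) := by
    refine dense_span_range_of_forall fun f hf => ?_
    -- Completeness is stated bilinearly, so it is applied to the conjugate of $f$.
    have h1 : star f = 0 := hcomplete _ fun n => by
      have h2 := hf n
      rw [inner_toLp] at h2
      exact (map_eq_zero _).1 h2
    have h3 : ∀ᵐ x, f x = 0 := by
      have h4 := Lp.coeFn_star f
      rw [h1] at h4
      filter_upwards [h4, Lp.coeFn_zero ℂ 2 (volume : Measure ℝ)] with x h5 h6
      rw [h6] at h5
      exact star_eq_zero.1 h5.symm
    exact (Lp.eq_zero_iff_ae_eq_zero).2 h3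
  have hχl : ∀ n, ∀ ψ : (schrodingerOp V).domain,
      ⟪χ n, schrodingerOp V ψ⟫_ℂ = E n * ⟪χ n, (ψ : L2R)⟫_ℂ := by
    intro n ψ
    have h1 : ((ψ : L2R), schrodingerOp V ψ) ∈ schrodingerGraph V := by
      rw [← schrodingerOp_graph]
      exact (schrodingerOp V).mem_graph ψ
    rw [hχ, hχ, hsymm n _ h1]
    ring
  refine ⟨⟨E, φ, χ, fun n => (mem_eigenspace_schrodingerOp _ _ _).2 (hφG n), hχl, fun m n => ?_,
    hφd, hχd⟩, fun e he => exists_eq_of_isEigenvalue hχl hχd he⟩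
  rw [hχ]
  split_ifs with hmn
  · rw [hmn]
    exact inv_mul_cancel₀ (hN n)
  · rw [horth m n hmn, mul_zero]

/-- A relation is a polynomial in $w^2$ vanishing on the whole line; as $\mathrm{Im}\,w^2=2cx$ is
injective in $x$, it has infinitely many roots. -/
lemma linearIndependent_wfun (hc : 0 < c) (m : ℝ) :
    LinearIndependent ℂ fun k : ℕ => wfun hc (m + 2 * k) := by
  let P : Polynomial ℂ →ₗ[ℂ] smoothFunctions :=
    (mulOp (wfun hc m)).comp (Polynomial.aeval (wpow hc 1 ^ 2)).toLinearMap
  have hP : ∀ p x, (P p).1 x = (wfun hc m).1 x * p.eval (rot c x ^ 2) := by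
    intro p x
    let ev : smoothFunctions →ₐ[ℂ] ℂ := (Pi.evalAlgHom ℂ (fun _ : ℝ => ℂ) x).comp smoothFunctions.val
    change (wfun hc m).1 x * ev (Polynomial.aeval (wpow hc 1 ^ 2) p) = _
    rw [← Polynomial.aeval_algHom_apply, map_pow, ← Polynomial.coe_aeval_eq_eval]
    have h1 : ev (wpow hc 1) = rot c x := by
      change rot c x ^ ((1 : ℝ) : ℂ) = _
      simp
    rw [h1]
  have hker : LinearMap.ker P = ⊥ := by
    refine LinearMap.ker_eq_bot'.2 fun p hp => ?_
    refine Polynomial.eq_zero_of_infinite_isRoot p ?_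
    have hinj : Function.Injective fun x : ℝ => rot c x ^ 2 := by
      intro x y hxy
      have h1 := congrArg Complex.im hxy
      simp only [pow_two, Complex.mul_im, rot_re, rot_im] at h1
      nlinarith
    refine (infinite_range_of_injective hinj).mono ?_
    rintro _ ⟨x, rfl⟩
    have h1 : (P p).1 x = 0 := by rw [hp]; rfl
    rw [hP] at h1
    exact (mul_eq_zero.1 h1).resolve_left (wfun_ne_zero hc m x)
  have h := (Polynomial.basisMonomials ℂ).linearIndependent.map' P hker
  have heq : (fun k : ℕ => wfun hc (m + 2 * k)) = P ∘ Polynomial.basisMonomials ℂ := by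
    funext k
    refine Subtype.ext (funext fun x => ?_)
    rw [Function.comp_apply, hP, wfun_add_two_mul, Polynomial.coe_basisMonomials,
      Polynomial.eval_monomial, one_mul, pow_mul]
  rw [heq]
  exact h

/-- The eigenfunctions of one of the two families, `σ = ± ξ`. -/
lemma exists_eigenfunctions (hc : 0 < c) {ξ σ : ℝ} (hσ : σ ^ 2 = ξ ^ 2) :
    ∃ u : ℕ → smoothFunctions,
      (∀ n, schrodingerExpr (oscPotential hc ξ) (u n) = (4 * (n : ℂ) + 2 + 2 * σ) • u n) ∧
      (∀ n, u n ≠ 0) ∧ (∀ n, MemLp (u n).1 2 volume) ∧ (∀ n, MemLp (D (u n)).1 2 volume) ∧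
      ∀ h : L2R, (∀ n, ∫ x, h x * (u n).1 x = 0) →
        ∀ k : ℕ, ∫ x, h x * (wfun hc (1 / 2 + σ + 2 * k)).1 x = 0 := by
  have hσ' : (σ : ℂ) ^ 2 = (ξ : ℂ) ^ 2 := by exact_mod_cast hσ
  -- The entries are read off at $m=1/2+\sigma+2k$. The off-diagonal one belongs to step $k+1$,
  -- hence $\sigma+2k+2$, and at the bottom $\sigma^2=\xi^2$ kills it.
  obtain ⟨u, hu, hu0, hspan, hspan'⟩ := exists_eigenvectors_of_triangular
    (schrodingerExpr (oscPotential hc ξ)).graph (fun k : ℕ => wfun hc (1 / 2 + σ + 2 * k))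
    (fun k => 4 * (k : ℂ) + 2 + 2 * σ) (fun k => ((σ : ℂ) + 2 * k + 2) ^ 2 - (ξ : ℂ) ^ 2)
    (fun j k hjk => by
      have h1 : (4 : ℂ) * j = 4 * k := by linear_combination hjk
      exact_mod_cast mul_left_cancel₀ (by norm_num : (4 : ℂ) ≠ 0) h1)
    (linearIndependent_wfun hc (1 / 2 + σ)) (by
      rw [LinearMap.mem_graph_iff]
      dsimp only
      rw [schrodingerExpr_wfun]
      have h1 : ((((1 / 2 + σ + 2 * ((0 : ℕ) : ℝ) : ℝ)) : ℂ) - 1 / 2) ^ 2 - (ξ : ℂ) ^ 2 = 0 := by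
        rw [← hσ']
        push_cast
        ring
      rw [h1, zero_smul, add_zero]
      congr 1
      push_cast
      ring) (fun k => by
      rw [LinearMap.mem_graph_iff]
      dsimp only
      rw [schrodingerExpr_wfun]
      have h1 : 1 / 2 + σ + 2 * ((k + 1 : ℕ) : ℝ) - 2 = 1 / 2 + σ + 2 * k := by
        push_cast
        ring
      rw [h1]
      congr 2
      · push_cast
        ring
      · push_cast
        ring)
  have hmem : ∀ y ∈ Submodule.span ℂ (range fun k : ℕ => wfun hc (1 / 2 + σ + 2 * k)),
      MemLp y.1 2 volume ∧ MemLp (D y).1 2 volume := by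
    intro y hy
    induction hy using Submodule.span_induction with
    | mem y hy => obtain ⟨k, rfl⟩ := hy; exact ⟨memLp_wfun hc _, memLp_D_wfun hc _⟩
    | zero => rw [map_zero]; exact ⟨MemLp.zero, MemLp.zero⟩
    | add x y _ _ hx hy => rw [map_add]; exact ⟨hx.1.add hy.1, hx.2.add hy.2⟩
    | smul a x _ hx => rw [map_smul]; exact ⟨hx.1.const_smul a, hx.2.const_smul a⟩
  refine ⟨u, fun n => ((LinearMap.mem_graph_iff _ _).1 (hu n)).symm, hu0,
    fun n => (hmem _ (hspan n)).1, fun n => (hmem _ (hspan n)).2, fun h hh k => ?_⟩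
  have horth : ∀ y ∈ Submodule.span ℂ (range u),
      (Integrable fun x => h x * y.1 x) ∧ ∫ x, h x * y.1 x = 0 := by
    intro y hy
    induction hy using Submodule.span_induction with
    | mem y hy =>
      obtain ⟨n, rfl⟩ := hy
      exact ⟨(Lp.memLp h).integrable_mul (hmem _ (hspan n)).1, hh n⟩
    | zero =>
      have h0 : (fun x => h x * (0 : smoothFunctions).1 x) = fun _ => (0 : ℂ) :=
        funext fun x => mul_zero _
      rw [h0]
      exact ⟨integrable_zero _ _ _, integral_zero _ _⟩
    | add x y _ _ hx hy =>
      have h0 : (fun t => h t * (x + y).1 t) = fun t => h t * x.1 t + h t * y.1 t :=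
        funext fun t => mul_add _ _ _
      rw [h0]
      exact ⟨hx.1.add hy.1, by rw [integral_add hx.1 hy.1, hx.2, hy.2, add_zero]⟩
    | smul a x _ hx =>
      have h0 : (fun t => h t * (a • x).1 t) = fun t => a * (h t * x.1 t) :=
        funext fun t => mul_left_comm _ _ _
      rw [h0]
      exact ⟨hx.1.const_mul a, by rw [integral_const_mul, hx.2, mul_zero]⟩
  exact (horth _ (hspan' k)).2

/-- The oscillator with non-integer parameter is diagonalizable and its spectrum of eigenvalues is
real. -/
theorem isDiagonalizable_oscillator (hc : 0 < c) {α : ℝ} (hα : 0 < α) (hα' : ∀ n : ℤ, α ≠ n) :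
    IsDiagonalizable (oscillator hc α) ∧ ∀ e, IsEigenvalue (oscillator hc α) e → e.im = 0 := by
  obtain ⟨u, hu, hu0, huL, huD, huc⟩ := exists_eigenfunctions hc (ξ := α) (σ := α) rfl
  obtain ⟨v, hv, hv0, hvL, hvD, hvc⟩ := exists_eigenfunctions hc (ξ := α) (σ := -α) (neg_sq α)
  let w : ℕ ⊕ ℕ → smoothFunctions := Sum.elim u v
  let E : ℕ ⊕ ℕ → ℝ := Sum.elim (fun n => 4 * n + 2 + 2 * α) fun n => 4 * n + 2 + 2 * -α
  -- The ladders share an eigenvalue only if $\alpha=k-j$; this is where non-integrality gives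
  -- distinct eigenvalues.
  have hne : ∀ j k : ℕ, 4 * (j : ℝ) + 2 + 2 * α ≠ 4 * k + 2 + 2 * -α := by
    intro j k h
    refine hα' (k - j) ?_
    push_cast
    linarith
  have hE : Function.Injective E := by
    rintro (j | j) (k | k) h
    · have h1 : 4 * (j : ℝ) + 2 + 2 * α = 4 * k + 2 + 2 * α := h
      have h2 : (j : ℝ) = k := by linarith
      rw [Nat.cast_injective h2]
    · exact (hne j k h).elim
    · exact (hne k j h.symm).elim
    · have h1 : 4 * (j : ℝ) + 2 + 2 * -α = 4 * k + 2 + 2 * -α := h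
      have h2 : (j : ℝ) = k := by linarith
      rw [Nat.cast_injective h2]
  have hw : ∀ i, schrodingerExpr (oscPotential hc α) (w i) = (E i : ℂ) • w i := by
    rintro (n | n)
    · refine (hu n).trans ?_
      change _ = ((4 * (n : ℝ) + 2 + 2 * α : ℝ) : ℂ) • u n
      push_cast
      rfl
    · refine (hv n).trans ?_
      change _ = ((4 * (n : ℝ) + 2 + 2 * -α : ℝ) : ℂ) • v n
      push_cast
      rfl
  let e : ℕ ≃ ℕ ⊕ ℕ := Equiv.natSumNatEquivNat.symm
  have h := isDiagonalizable_of_complete (V := oscPotential hc α) (u := w ∘ e)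
    (E := fun n => (E (e n) : ℂ)) (Complex.ofReal_injective.comp (hE.comp e.injective))
    (fun n => hw (e n)) (fun n => by rcases h : e n with k | k <;> simp [w, h, hu0, hv0])
    (fun n => by
      rw [Function.comp_apply]
      rcases e n with k | k
      · exact huL k
      · exact hvL k)
    (fun n => by
      rw [Function.comp_apply]
      rcases e n with k | k
      · exact huD k
      · exact hvD k)
    (fun f hf => by
      have hf' : ∀ i, ∫ x, f x * (w i).1 x = 0 := fun i => by
        have := hf (e.symm i)
        rwa [Function.comp_apply, e.apply_symm_apply] at this
      refine eq_zero_of_moments_eq_zero hc hα hα' f (huc f fun n => hf' (Sum.inl n)) fun k => ?_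
      have h1 := hvc f (fun n => hf' (Sum.inr n)) k
      rwa [← sub_eq_add_neg] at h1)
  refine ⟨h.1, fun z hz => ?_⟩
  obtain ⟨n, rfl⟩ := h.2 z hz
  exact Complex.ofReal_im _

/-! ### The sub-Hamiltonians -/

lemma hamL_eq (hc : 0 < c) (γ : ℝ) :
    hamL hc γ = translate (-(2 * (γ : ℂ) + 2)) (oscillator hc |γ|) := rfl

lemma hamR_eq (hc : 0 < c) (γ : ℝ) :
    hamR hc γ = translate (-(2 * (γ : ℂ))) (oscillator hc |γ + 1|) := rfl

/-- Only $|a|$ enters the oscillator, so every integer, of either sign, reduces to the Jordan chain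
at a natural number. -/
lemma isExceptionalPoint_of_translate {hc : 0 < c} {T : ℝ → L2R →ₗ.[ℂ] L2R} {γ a : ℝ} {b : ℂ}
    (hT : T γ = translate b (oscillator hc |a|)) (ha : a ∈ range ((↑) : ℤ → ℝ)) :
    IsExceptionalPoint T γ := by
  obtain ⟨K, rfl⟩ := ha
  obtain ⟨e, he, hne⟩ := exists_multiplicity_ne hc K.natAbs
  have hK : ((K.natAbs : ℕ) : ℝ) = |(K : ℝ)| := by
    rw [Nat.cast_natAbs, Int.cast_abs]
  rw [hK] at he hne
  refine ⟨e + b, ?_, ?_⟩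
  · rw [hT]
    exact isEigenvalue_translate.2 he
  · rw [hT]
    exact multiplicity_translate hne

lemma isDiagonalizable_translate_oscillator (hc : 0 < c) {a b : ℝ}
    (ha : a ∉ range ((↑) : ℤ → ℝ)) :
    IsDiagonalizable (translate (b : ℂ) (oscillator hc |a|)) ∧
      ∀ e, IsEigenvalue (translate (b : ℂ) (oscillator hc |a|)) e → e.im = 0 := by
  have ha0 : 0 < |a| := abs_pos.2 fun h => ha ⟨0, by rw [h, Int.cast_zero]⟩
  have hne : ∀ n : ℤ, |a| ≠ n := by
    intro n hn
    rcases abs_choice a with h | h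
    · exact ha ⟨n, by rw [← hn, h]⟩
    · exact ha ⟨-n, by rw [Int.cast_neg, ← hn, h, neg_neg]⟩
  obtain ⟨h1, h2⟩ := isDiagonalizable_oscillator hc ha0 hne
  refine ⟨h1.translate _, fun e he => ?_⟩
  have h3 := h2 (e - b) (isEigenvalue_translate.1 (by rwa [sub_add_cancel]))
  simpa using h3

lemma add_one_mem_range_intCast {γ : ℝ} :
    γ + 1 ∈ range ((↑) : ℤ → ℝ) ↔ γ ∈ range ((↑) : ℤ → ℝ) := by
  constructor
  · rintro ⟨n, hn⟩
    exact ⟨n - 1, by rw [Int.cast_sub, hn]; simp⟩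
  · rintro ⟨n, rfl⟩
    exact ⟨n + 1, by simp⟩

lemma isExceptionalPoint_hamL (hc : 0 < c) {γ : ℝ} (h : γ ∈ range ((↑) : ℤ → ℝ)) :
    IsExceptionalPoint (hamL hc) γ :=
  isExceptionalPoint_of_translate (hamL_eq hc γ) h

lemma isExceptionalPoint_hamR (hc : 0 < c) {γ : ℝ} (h : γ ∈ range ((↑) : ℤ → ℝ)) :
    IsExceptionalPoint (hamR hc) γ :=
  isExceptionalPoint_of_translate (hamR_eq hc γ) (add_one_mem_range_intCast.2 h)

lemma isDiagonalizable_hamL (hc : 0 < c) {γ : ℝ} (h : γ ∉ range ((↑) : ℤ → ℝ)) :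
    IsDiagonalizable (hamL hc γ) ∧ ∀ e, IsEigenvalue (hamL hc γ) e → e.im = 0 := by
  have := isDiagonalizable_translate_oscillator hc (b := -(2 * γ + 2)) h
  push_cast at this
  exact this

lemma isDiagonalizable_hamR (hc : 0 < c) {γ : ℝ} (h : γ ∉ range ((↑) : ℤ → ℝ)) :
    IsDiagonalizable (hamR hc γ) ∧ ∀ e, IsEigenvalue (hamR hc γ) e → e.im = 0 := by
  have := isDiagonalizable_translate_oscillator hc (b := -(2 * γ))
    (mt add_one_mem_range_intCast.1 h)
  push_cast at this
  exact this

lemma setOf_isExceptionalPoint_hamL (hc : 0 < c) :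
    {γ : ℝ | IsExceptionalPoint (hamL hc) γ} = range ((↑) : ℤ → ℝ) :=
  Subset.antisymm (fun _ hγ => by_contra fun h =>
    IsExceptionalPoint.not_isDiagonalizable hγ (isDiagonalizable_hamL hc h).1)
    fun _ => isExceptionalPoint_hamL hc

lemma setOf_isExceptionalPoint_hamR (hc : 0 < c) :
    {γ : ℝ | IsExceptionalPoint (hamR hc) γ} = range ((↑) : ℤ → ℝ) :=
  Subset.antisymm (fun _ hγ => by_contra fun h =>
    IsExceptionalPoint.not_isDiagonalizable hγ (isDiagonalizable_hamR hc h).1)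
    fun _ => isExceptionalPoint_hamR hc

lemma admissible_eq (hc : 0 < c) : admissible hc = (range ((↑) : ℤ → ℝ))ᶜ :=
  Subset.antisymm
    (fun _ hγ h => (isExceptionalPoint_hamL hc h).not_isDiagonalizable hγ.1.1)
    fun _ h => ⟨isDiagonalizable_hamL hc h, isDiagonalizable_hamR hc h⟩

end SusyEP

end

theorem mainTheorem1 (c : ℝ) (hc : 0 < c) :
    -- for every real `γ` the operators realize the SUSY algebra
    (∀ γ : ℝ, IsSl11 (superG hc γ) (superQ hc γ) (superQt hc γ)) ∧
    -- the exceptional points of each sub-Hamiltonian are exactly the integers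
    {γ : ℝ | IsExceptionalPoint (hamL hc) γ} = Set.range ((↑) : ℤ → ℝ) ∧
    {γ : ℝ | IsExceptionalPoint (hamR hc) γ} = Set.range ((↑) : ℤ → ℝ) ∧
    -- where neither of them is diagonalizable
    (∀ K : ℤ, ¬ IsDiagonalizable (hamL hc (K : ℝ)) ∧ ¬ IsDiagonalizable (hamR hc (K : ℝ))) ∧
    -- all the other parameters are admissible
    admissible hc = (Set.range ((↑) : ℤ → ℝ))ᶜ ∧
    -- the maximal ranges of admissible parameters are the unit intervals between integers
    (∀ γ ∈ admissible hc,
      connectedComponentIn (admissible hc) γ = Set.Ioo (⌊γ⌋ : ℝ) ((⌊γ⌋ : ℝ) + 1)) ∧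
    (connectedComponentIn (admissible hc) '' admissible hc =
      Set.range fun K : ℤ => Set.Ioo (K : ℝ) ((K : ℝ) + 1)) ∧
    -- and there are infinitely many of them
    (connectedComponentIn (admissible hc) '' admissible hc).Infinite := by
  refine ⟨isSl11 hc, setOf_isExceptionalPoint_hamL hc, setOf_isExceptionalPoint_hamR hc,
    fun K => ⟨(isExceptionalPoint_hamL hc ⟨K, rfl⟩).not_isDiagonalizable,
      (isExceptionalPoint_hamR hc ⟨K, rfl⟩).not_isDiagonalizable⟩, admissible_eq hc, ?_⟩
  rw [admissible_eq hc, connectedComponentIn_image_compl_range_intCast]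
  exact ⟨fun γ hγ => connectedComponentIn_compl_range_intCast hγ, rfl, infinite_range_Ioo_intCast⟩
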